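/- Write $r=(x_1^2+x_2^2)^{1/2}$, $z=x_3$, $\nabla_h=(\partial_1,\partial_2)$, $(Oz)=\{r=0\}$, $\Pi_z(x)=z$, $u_r=(x_1u_1+x_2u_2)/r$ and $\omega=\operatorname{curl}u$; $|\nabla_h v|$ is the Euclidean norm of all the components $\partial_i v_j$, $i\in\{1,2\}$, $j\in\{1,2,3\}$. Let $T\ge 0$, and let $u:[0,T]\times\mathbb R^3\to\mathbb R^3$ be smooth, with $\operatorname{div}u(t)=0$ and $u(t)$ axisymmetric (that is, commuting with the rotations about $(Oz)$) for every $t\in[0,T]$. Suppose that $\nabla_h u(\tau),\nabla_h\omega(\tau)\in L^2(\mathbb R^3)$ for almost every $\tau\in[0,T]$ and that $$\int_0^T\Big\|\frac{u_r}{r}(\tau)\Big\|_{L^\infty}d\tau<\infty,\qquad \int_0^T\|\nabla_h u(\tau)\|_{L^2}^{1/2}\|\nabla_h\omega(\tau)\|_{L^2}^{1/2}d\tau<\infty .$$ Let $\rho_0\in L^2(\mathbb R^3)\cap L^\infty(\mathbb R^3)$ satisfy $$r_0:=d\big(\operatorname{Supp}\rho_0,(Oz)\big)>0,\qquad d_0:=\operatorname{diam}\Pi_z(\operatorname{Supp}\rho_0)<\infty,$$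 where $\operatorname{Supp}\rho_0$ is the complement of the largest open set on which $\rho_0=0$ almost everywhere (if $\rho_0=0$ a.e., then $r_0=\infty$ and $r_0^{-2}=0$). Let $\rho$ be a weak solution on $[0,T]$ of $$\partial_t\rho+u\cdot\nabla\rho=0,\qquad \rho|_{t=0}=\rho_0,$$ that is, $\rho$ is locally integrable on $[0,T]\times\mathbb R^3$, $\rho(t)$ is locally integrable on $\mathbb R^3$ for every $t\in[0,T]$, and $$\int\rho(t)\varphi(t)\,dx-\int\rho_0\,\varphi(0)\,dx=\int_0^t\!\!\int\rho\,(\partial_t\varphi+u\cdot\nabla\varphi)\,dx\,d\tau$$ for all $\varphi\in C_c^\infty(\mathbb R\times\mathbb R^3)$ and all $t\in[0,T]$. Then, for every $t\in[0,T]$, $$\Big\|\frac{\rho}{r}(t)\Big\|_{L^2}^2\le\frac1{r_0^2}\|\rho_0\|_{L^2}^2+2\pi\|\rho_0\|_{L^\infty}^2\int_0^t\Big\|\frac{u_r}{r}(\tau)\Big\|_{L^\infty}d\tau\,\Big(d_0+2\int_0^t\|\nabla_h u(\tau)\|_{L^2}^{1/2}\|\nabla_h\omega(\tau)\|_{L^2}^{1/2}d\tau\Big).$$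 -/

import Mathlib

open MeasureTheory Set Topology
open scoped ENNReal ContDiff

namespace Axisym

/-- Three-dimensional Euclidean space; the coordinates `x 0, x 1, x 2` are `x₁, x₂, z`. -/
abbrev E3 : Type := EuclideanSpace ℝ (Fin 3)

/-- The distance to the axis, `r = (x₁² + x₂²)^{1/2}`. -/
noncomputable def r (x : E3) : ℝ := √(x 0 ^ 2 + x 1 ^ 2)

/-- The vertical axis `(Oz)`. -/
def axis : Set E3 := {x | x 0 = 0 ∧ x 1 = 0}

/-- The rotation of angle `α` about the axis `(Oz)`. -/
noncomputable def rotZ (α : ℝ) (x : E3) : E3 :=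
  !₂[Real.cos α * x 0 - Real.sin α * x 1, Real.sin α * x 0 + Real.cos α * x 1, x 2]

/-- A vector field is axisymmetric if it commutes with all rotations about `(Oz)`, that is, if its
cylindrical components `u_r, u_θ, u_z` depend on `(r, z)` only. A swirl `u_θ` is allowed. -/
def IsAxisymmetric (v : E3 → E3) : Prop :=
  ∀ (α : ℝ) (x : E3), v (rotZ α x) = rotZ α (v x)

/-- The partial derivative `∂ᵢ v`. -/
noncomputable def pd (i : Fin 3) (v : E3 → E3) (x : E3) : E3 :=
  fderiv ℝ v x (EuclideanSpace.single i 1)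

/-- The divergence. -/
noncomputable def div (v : E3 → E3) (x : E3) : ℝ := ∑ i, pd i v x i

/-- The curl. -/
noncomputable def curl (v : E3 → E3) (x : E3) : E3 :=
  !₂[pd 1 v x 2 - pd 2 v x 1, pd 2 v x 0 - pd 0 v x 2, pd 0 v x 1 - pd 1 v x 0]

/-- The pointwise Euclidean norm `|∇_h v| = (|∂₁ v|² + |∂₂ v|²)^{1/2}` of the horizontal gradient
`∇_h v = (∂₁ v, ∂₂ v)`. -/
noncomputable def hGrad (v : E3 → E3) (x : E3) : ℝ := √(‖pd 0 v x‖ ^ 2 + ‖pd 1 v x‖ ^ 2)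

/-- The radial component `u_r = u · e_r`, with `e_r = (x₁/r, x₂/r, 0)`. -/
noncomputable def radial (v : E3 → E3) (x : E3) : ℝ := (x 0 * v x 0 + x 1 * v x 1) / r x

/-- The support of a function that is defined up to null sets: the complement of the largest open
set on which it vanishes almost everywhere. -/
def essSupport (f : E3 → ℝ) : Set E3 :=
  {x | ∀ U ∈ 𝓝 x, ¬ (∀ᵐ y ∂(volume.restrict U), f y = 0)}

/-- The distance `d(Supp f, (Oz))`. -/
noncomputable def suppAxisDist (f : E3 → ℝ) : ℝ≥0∞ :=
  ⨅ x ∈ essSupport f, Metric.infEDist x axis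

/-- The diameter of `Π_z(Supp f)`, where `Π_z x = z`. -/
noncomputable def suppHeight (f : E3 → ℝ) : ℝ≥0∞ :=
  Metric.ediam ((fun x : E3 => x 2) '' essSupport f)

/-- `ρ` is a weak solution on `[0, T]` of `∂ₜ ρ + u · ∇ρ = 0`, `ρ(0) = ρ₀`, for a divergence-free
field `u`: for every smooth compactly supported `φ` and every `t ∈ [0, T]`,
`∫ ρ(t) φ(t) - ∫ ρ₀ φ(0) = ∫₀ᵗ ∫ ρ (∂ₜ φ + u · ∇φ)`.
Here `fderiv ℝ φ (τ, x) (1, u τ x)` is `∂ₜ φ + u · ∇φ` at `(τ, x)`. -/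
structure IsTransportSolution (T : ℝ) (u : ℝ → E3 → E3) (ρ₀ : E3 → ℝ) (ρ : ℝ → E3 → ℝ) :
    Prop where
  locallyIntegrableOn :
    LocallyIntegrableOn (fun p : ℝ × E3 => ρ p.1 p.2) (Icc 0 T ×ˢ univ) volume
  locallyIntegrable : ∀ t ∈ Icc 0 T, LocallyIntegrable (ρ t) volume
  weak_eq : ∀ φ : ℝ × E3 → ℝ, ContDiff ℝ ∞ φ → HasCompactSupport φ → ∀ t ∈ Icc 0 T,
    (∫ x, ρ t x * φ (t, x)) - ∫ x, ρ₀ x * φ (0, x) =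
      ∫ τ in (0 : ℝ)..t, ∫ x, ρ τ x * fderiv ℝ φ (τ, x) (1, u τ x)

/-- `∫₀ᵗ ‖(u_r / r)(τ)‖_{L^∞} dτ`. -/
noncomputable def radialInt (u : ℝ → E3 → E3) (t : ℝ) : ℝ≥0∞ :=
  ∫⁻ τ in Icc 0 t, eLpNorm (fun x => radial (u τ) x / r x) ⊤ volume

/-- `∫₀ᵗ ‖∇_h u(τ)‖_{L²}^{1/2} ‖∇_h ω(τ)‖_{L²}^{1/2} dτ`, where `ω = curl u`. -/
noncomputable def hGradInt (u : ℝ → E3 → E3) (t : ℝ) : ℝ≥0∞ :=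
  ∫⁻ τ in Icc 0 t, eLpNorm (hGrad (u τ)) 2 volume ^ (1 / 2 : ℝ) *
    eLpNorm (hGrad (curl (u τ))) 2 volume ^ (1 / 2 : ℝ)

end Axisym

/-! The density is carried by the flow of `u`. Along a trajectory the derivative of log r is u_r/r,
so up to time t the distance to the axis changes by a factor at most e^G, where G = ∫₀ᵗ ‖u_r/r‖_∞;
the support of ρ(t) stays in {r ≥ r₀ e^{-G}}. Two trajectories separate vertically no faster than
the oscillation of u₃, so the heights of the support fill an interval of length at most h = d₀ + 2
∫₀ᵗ ‖∇_h u‖^{1/2} ‖∇_h ω‖^{1/2}. Now split the integral of ρ²/r² at r = r₀. Where r ≥ r₀, bound 1/r²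
by 1/r₀² and use that the flow preserves volume. Where r < r₀, bound |ρ| by ‖ρ₀‖_∞ and integrate
r^{-2} over r₀ e^{-G} ≤ r < r₀ and heights in an interval of length h: this gives 2π G h. This is
`lintegral_div_r_sq_le`.

The oscillation bound is an Agmon inequality on ℝ³ with an explicit constant,
`abs_sub_le_sqrt_gradient_laplacian`. A weighted average of v over a ball of radius s has an
s-derivative controlled by ‖∇v‖ s^{-3/2}, and also, after an integration by parts, by ‖Δv‖ s^{-1/2}.
Use the second rate at small scales and the first at large ones, let the large scale tend to
infinity, and optimise the splitting scale. For v = u₃, incompressibility bounds ∇u₃ by ∇_h u, and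
Δu₃ = ∂₂ω₁ − ∂₁ω₂ involves horizontal derivatives of ω only (`enorm_vertical_sub_le`).

It remains to represent a merely weak solution by the flow, for a field with no global bound
(`IsTransportSolution.exists_backward_map`). The field is cut off to become bounded and Lipschitz.
The bounds on r and z along trajectories do not depend on the cutoff, so trajectories meeting a
given ball stay where the cutoff equals 1. A test function χ at time t is extended to be constant
along the flow. This extension is only Lipschitz, but mollifying it at radius ε leaves a transport
error O(ε), whence ∫ ρ(t) χ = ∫ ρ₀ χ∘e with e the flow map (`IsTransportSolution.integral_mul_eq`).
Applied to the constant solution 1, the same identity gives preservation of volume without computing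
a Jacobian. -/

namespace Axisym

/-! ### Calculus preliminaries -/

/-- Differentiation under the integral sign for integrands supported in a fixed compact set. -/
theorem hasDerivAt_integral_of_continuous_of_compact {E : Type*} [TopologicalSpace E]
    [MeasurableSpace E] [OpensMeasurableSpace E] [SecondCountableTopology E] [T2Space E]
    {μ : Measure E} [IsFiniteMeasureOnCompacts μ] {F F' : ℝ → E → ℝ} {K : Set E}
    (hK : IsCompact K) (hKm : MeasurableSet K)
    (hF : Continuous (Function.uncurry F)) (hF' : Continuous (Function.uncurry F'))
    (hs : ∀ l, ∀ y ∉ K, F l y = 0) (hs' : ∀ l, ∀ y ∉ K, F' l y = 0)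
    (hd : ∀ l y, HasDerivAt (fun l => F l y) (F' l y) l) (l₀ : ℝ) :
    HasDerivAt (fun l => ∫ y, F l y ∂μ) (∫ y, F' l₀ y ∂μ) l₀ := by
  obtain ⟨C, hC⟩ := ((isCompact_closedBall l₀ 1).prod hK).exists_bound_of_continuousOn
    hF'.continuousOn
  have hFc : ∀ l, Continuous (F l) := fun l => hF.comp (Continuous.prodMk_right l)
  have hF'c : ∀ l, Continuous (F' l) := fun l => hF'.comp (Continuous.prodMk_right l)
  refine (hasDerivAt_integral_of_dominated_loc_of_deriv_le (μ := μ)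
    (bound := K.indicator (fun _ => C)) (Metric.closedBall_mem_nhds l₀ one_pos)
    (Filter.Eventually.of_forall fun l => (hFc l).aestronglyMeasurable) ?_
    (hF'c l₀).aestronglyMeasurable ?_ ?_ ?_).2
  · have : F l₀ = K.indicator (F l₀) := by
      ext y; by_cases hy : y ∈ K <;> simp [hy, hs]
    rw [this, integrable_indicator_iff hKm]
    exact (hFc l₀).continuousOn.integrableOn_compact hK
  · refine Filter.Eventually.of_forall fun y l hl => ?_
    by_cases hy : y ∈ K
    · simpa [hy] using hC (l, y) ⟨hl, hy⟩
    · simp [hy, hs']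
  · rw [integrable_indicator_iff hKm]
    exact integrableOn_const hK.measure_lt_top.ne
  · exact Filter.Eventually.of_forall fun y l _ => hd l y

theorem integral_abs_mul_le_sqrt_mul_sqrt {α : Type*} [MeasurableSpace α] {μ : Measure α}
    {f g : α → ℝ} (hf : MemLp f 2 μ) (hg : MemLp g 2 μ) :
    ∫ x, |f x| * |g x| ∂μ ≤ √(∫ x, f x ^ 2 ∂μ) * √(∫ x, g x ^ 2 ∂μ) := by
  have h := integral_mul_le_Lp_mul_Lq_of_nonneg (μ := μ) Real.HolderConjugate.two_two
    (f := fun x => |f x|) (g := fun x => |g x|)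
    (Filter.Eventually.of_forall fun _ => abs_nonneg _)
    (Filter.Eventually.of_forall fun _ => abs_nonneg _)
    (by rw [ENNReal.ofReal_ofNat]; exact hf.abs) (by rw [ENNReal.ofReal_ofNat]; exact hg.abs)
  simpa [Real.sqrt_eq_rpow] using h

theorem hasDerivAt_max_zero_pow_four (t : ℝ) :
    HasDerivAt (fun t : ℝ => max 0 t ^ 4) (4 * max 0 t ^ 3) t := by
  rcases lt_trichotomy t 0 with h | h | h
  · have : (fun t : ℝ => max 0 t ^ 4) =ᶠ[𝓝 t] fun _ => 0 := by
      filter_upwards [gt_mem_nhds h] with s hs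
      rw [max_eq_left hs.le]; norm_num
    rw [max_eq_left h.le]
    simpa using (hasDerivAt_const t (0 : ℝ)).congr_of_eventuallyEq this
  · subst h
    rw [hasDerivAt_iff_isLittleO]
    simp only [max_self, ne_eq, OfNat.ofNat_ne_zero, not_false_eq_true, zero_pow, mul_zero,
      smul_zero, sub_zero]
    refine Asymptotics.IsBigO.trans_isLittleO (g := fun t : ℝ => t ^ 4) ?_ ?_
    · refine Asymptotics.IsBigO.of_bound 1 (Filter.Eventually.of_forall fun s => ?_)
      rcases le_total s 0 with hs | hs
      · rw [max_eq_left hs]; simp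
      · rw [max_eq_right hs]; simp
    · simpa using Asymptotics.isLittleO_pow_id (𝕜 := ℝ) (n := 4) (by norm_num)
  · have : (fun t : ℝ => max 0 t ^ 4) =ᶠ[𝓝 t] fun s => s ^ 4 := by
      filter_upwards [lt_mem_nhds h] with s hs
      rw [max_eq_right hs.le]
    rw [max_eq_right h.le]
    simpa using (hasDerivAt_pow 4 t).congr_of_eventuallyEq this

/-- The minimiser is s = √(b/a). Since a or b may vanish, both are first increased by e > 0, and
then e tends to 0. -/
theorem le_two_mul_sqrt_of_forall_le {a b c : ℝ} (ha : 0 ≤ a) (hb : 0 ≤ b)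
    (h : ∀ s : ℝ, 0 < s → c ≤ a * s + b / s) : c ≤ 2 * √(a * b) := by
  have key : ∀ e : ℝ, 0 < e → c ≤ 2 * √((a + e) * (b + e)) := by
    intro e he
    have ha' : 0 < a + e := by linarith
    have hb' : 0 < b + e := by linarith
    have hs : 0 < √(b + e) / √(a + e) := by positivity
    refine (h _ hs).trans ?_
    rw [Real.sqrt_mul ha'.le]
    have h1 : a * (√(b + e) / √(a + e)) ≤ √(a + e) * √(b + e) := by
      rw [← mul_div_assoc, div_le_iff₀ (by positivity)]
      have := Real.mul_self_sqrt ha'.le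
      nlinarith [Real.sqrt_nonneg (b + e)]
    have h2 : b / (√(b + e) / √(a + e)) ≤ √(a + e) * √(b + e) := by
      rw [div_div_eq_mul_div, div_le_iff₀ (by positivity)]
      have := Real.mul_self_sqrt hb'.le
      nlinarith [Real.sqrt_nonneg (a + e)]
    linarith
  have hc : ContinuousWithinAt (fun e : ℝ => 2 * √((a + e) * (b + e))) (Ioi 0) 0 := by
    have : Continuous (fun e : ℝ => 2 * √((a + e) * (b + e))) := by fun_prop
    exact this.continuousWithinAt
  have := ge_of_tendsto hc (Filter.eventually_of_mem self_mem_nhdsWithin key)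
  simpa using this

/-! ### The radial bump, its gradient weight, and their exact moments -/

theorem integral_fun_norm_cutoff (f : ℝ → ℝ) (hf : ∀ s, 1 ≤ s → f s = 0) :
    ∫ x : E3, f ‖x‖ = 4 * Real.pi * ∫ s in (0 : ℝ)..1, s ^ 2 * f s := by
  rw [integral_fun_norm_addHaar, intervalIntegral.integral_of_le zero_le_one]
  have h1 : ∫ s in Ioi (0 : ℝ), s ^ (Module.finrank ℝ E3 - 1) • f s
      = ∫ s in Ioc (0 : ℝ) 1, s ^ 2 * f s := by
    have h3 : Module.finrank ℝ E3 - 1 = 2 := by simp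
    simp only [h3, smul_eq_mul]
    refine (setIntegral_eq_of_subset_of_forall_sdiff_eq_zero (f := fun s => s ^ 2 * f s)
      measurableSet_Ioi
      (Ioc_subset_Ioi_self : Ioc (0 : ℝ) 1 ⊆ Ioi 0) fun s hs => ?_)
    have : 1 ≤ s := by
      by_contra h
      exact hs.2 ⟨hs.1, (not_le.1 h).le⟩
    simp [hf s this]
  rw [h1, Measure.real, EuclideanSpace.volume_ball_fin_three]
  simp [ENNReal.toReal_ofReal (show 0 ≤ Real.pi * 4 / 3 by positivity)]
  ring

theorem integral_polynomial_eq {f p q : ℝ → ℝ} {c : ℝ} (hf : ∀ s ∈ Icc (0 : ℝ) 1, f s = p s)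
    (hq : ∀ s, HasDerivAt q (p s) s) (hp : Continuous p) (hc : q 1 - q 0 = c) :
    ∫ s in (0 : ℝ)..1, f s = c := by
  rw [← hc, ← intervalIntegral.integral_eq_sub_of_hasDerivAt (fun s _ => hq s)
    (hp.intervalIntegrable _ _)]
  refine intervalIntegral.integral_congr fun s hs => hf s ?_
  rwa [uIcc_of_le zero_le_one] at hs

theorem max_zero_one_sub_sq {s : ℝ} (hs : s ∈ Icc (0 : ℝ) 1) : max 0 (1 - s ^ 2) = 1 - s ^ 2 :=
  max_eq_right (by nlinarith [hs.1, hs.2])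

/-- The radial bump `(1 - |y|²)₊⁴`. -/
noncomputable def bump (y : E3) : ℝ := max 0 (1 - ‖y‖ ^ 2) ^ 4

/-- The radial weight `φ` with `∇ bump = -φ y`. -/
noncomputable def weight (y : E3) : ℝ := 8 * max 0 (1 - ‖y‖ ^ 2) ^ 3

theorem integral_weight : ∫ y, weight y = 4 * Real.pi * (128 / 315) := by
  have h := integral_fun_norm_cutoff (fun s => 8 * max 0 (1 - s ^ 2) ^ 3)
    (fun s hs => by rw [max_eq_left (by nlinarith)]; norm_num)
  rw [show weight = fun y : E3 => 8 * max 0 (1 - ‖y‖ ^ 2) ^ 3 from rfl, h]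
  congr 1
  refine integral_polynomial_eq (p := fun s => 8 * s ^ 2 - 24 * s ^ 4 + 24 * s ^ 6 - 8 * s ^ 8)
    (q := fun s => 8 / 3 * s ^ 3 - 24 / 5 * s ^ 5 + 24 / 7 * s ^ 7 - 8 / 9 * s ^ 9)
    (fun s hs => by rw [max_zero_one_sub_sq hs]; ring) (fun s => ?_) (by fun_prop) (by norm_num)
  convert! ((((hasDerivAt_pow 3 s).const_mul (8 / 3)).sub ((hasDerivAt_pow 5 s).const_mul
    (24 / 5))).add ((hasDerivAt_pow 7 s).const_mul (24 / 7))).sub ((hasDerivAt_pow 9 s).const_mul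
    (8 / 9)) using 1
  norm_num
  ring

theorem integral_bump_sq : ∫ y, bump y ^ 2 = 4 * Real.pi * (32768 / 2078505) := by
  have h := integral_fun_norm_cutoff (fun s => (max 0 (1 - s ^ 2) ^ 4) ^ 2)
    (fun s hs => by rw [max_eq_left (by nlinarith)]; norm_num)
  rw [show (fun y => bump y ^ 2) = fun y : E3 => (max 0 (1 - ‖y‖ ^ 2) ^ 4) ^ 2 from rfl, h]
  congr 1
  refine integral_polynomial_eq (p := fun s => s ^ 2 - 8 * s ^ 4 + 28 * s ^ 6 - 56 * s ^ 8
      + 70 * s ^ 10 - 56 * s ^ 12 + 28 * s ^ 14 - 8 * s ^ 16 + s ^ 18)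
    (q := fun s => 1 / 3 * s ^ 3 - 8 / 5 * s ^ 5 + 28 / 7 * s ^ 7 - 56 / 9 * s ^ 9
      + 70 / 11 * s ^ 11 - 56 / 13 * s ^ 13 + 28 / 15 * s ^ 15 - 8 / 17 * s ^ 17 + 1 / 19 * s ^ 19)
    (fun s hs => by rw [max_zero_one_sub_sq hs]; ring) (fun s => ?_) (by fun_prop) (by norm_num)
  have h (n : ℕ) (c : ℝ) := (hasDerivAt_pow n s).const_mul c
  convert! ((((((((h 3 (1 / 3)).sub (h 5 (8 / 5))).add (h 7 (28 / 7))).sub (h 9 (56 / 9))).add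
    (h 11 (70 / 11))).sub (h 13 (56 / 13))).add (h 15 (28 / 15))).sub (h 17 (8 / 17))).add
    (h 19 (1 / 19)) using 1
  norm_num
  ring

theorem integral_weight_mul_norm_sq :
    ∫ y, (weight y * ‖y‖) ^ 2 = 4 * Real.pi * (65536 / 255255) := by
  have h := integral_fun_norm_cutoff (fun s => (8 * max 0 (1 - s ^ 2) ^ 3 * s) ^ 2)
    (fun s hs => by rw [max_eq_left (by nlinarith)]; norm_num)
  rw [show (fun y => (weight y * ‖y‖) ^ 2)
    = fun y : E3 => (8 * max 0 (1 - ‖y‖ ^ 2) ^ 3 * ‖y‖) ^ 2 from rfl, h]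
  congr 1
  refine integral_polynomial_eq (p := fun s => 64 * (s ^ 4 - 6 * s ^ 6 + 15 * s ^ 8 - 20 * s ^ 10
      + 15 * s ^ 12 - 6 * s ^ 14 + s ^ 16))
    (q := fun s => 64 * (1 / 5 * s ^ 5 - 6 / 7 * s ^ 7 + 15 / 9 * s ^ 9 - 20 / 11 * s ^ 11
      + 15 / 13 * s ^ 13 - 6 / 15 * s ^ 15 + 1 / 17 * s ^ 17))
    (fun s hs => by rw [max_zero_one_sub_sq hs]; ring) (fun s => ?_) (by fun_prop) (by norm_num)
  have h (n : ℕ) (c : ℝ) := (hasDerivAt_pow n s).const_mul c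
  convert! (((((((h 5 (1 / 5)).sub (h 7 (6 / 7))).add (h 9 (15 / 9))).sub (h 11 (20 / 11))).add
    (h 13 (15 / 13))).sub (h 15 (6 / 15))).add (h 17 (1 / 17))).const_mul 64 using 1
  norm_num
  ring

theorem continuous_bump : Continuous bump := by unfold bump; fun_prop

theorem continuous_weight : Continuous weight := by unfold weight; fun_prop

theorem max_zero_one_sub_norm_sq_eq_zero {y : E3} (hy : y ∉ Metric.closedBall (0 : E3) 1) :
    max 0 (1 - ‖y‖ ^ 2) = 0 := by
  rw [mem_closedBall_zero_iff, not_le] at hy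
  exact max_eq_left (by nlinarith)

theorem bump_eq_zero {y : E3} (hy : y ∉ Metric.closedBall (0 : E3) 1) : bump y = 0 := by
  simp [bump, max_zero_one_sub_norm_sq_eq_zero hy]

theorem weight_eq_zero {y : E3} (hy : y ∉ Metric.closedBall (0 : E3) 1) : weight y = 0 := by
  simp [weight, max_zero_one_sub_norm_sq_eq_zero hy]

theorem hasCompactSupport_of_eq_zero_off_closedBall {f : E3 → ℝ} {R : ℝ}
    (hf : ∀ y ∉ Metric.closedBall (0 : E3) R, f y = 0) : HasCompactSupport f :=
  HasCompactSupport.intro (isCompact_closedBall 0 R) hf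

theorem hasFDerivAt_bump (y : E3) : HasFDerivAt bump (-(weight y) • innerSL ℝ y) y := by
  have h1 : HasFDerivAt (fun y : E3 => 1 - ‖y‖ ^ 2) (-(2 • innerSL ℝ y)) y :=
    ((hasStrictFDerivAt_norm_sq y).hasFDerivAt).const_sub 1
  have h2 := (hasDerivAt_max_zero_pow_four (1 - ‖y‖ ^ 2)).comp_hasFDerivAt y h1
  refine h2.congr_fderiv ?_
  ext w
  simp [weight]
  ring

/-! ### Averages over balls and the Agmon-type inequality -/

theorem sum_coord_mul_eq (L : E3 →L[ℝ] ℝ) (y : E3) :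
    L y = ∑ i, y i * L (EuclideanSpace.single i 1) := by
  conv_lhs => rw [← (EuclideanSpace.basisFun (Fin 3) ℝ).sum_repr y]
  simp

theorem continuous_memLp_two {f : E3 → ℝ} {R : ℝ} (hc : Continuous f)
    (hf : ∀ y ∉ Metric.closedBall (0 : E3) R, f y = 0) : MemLp f 2 volume :=
  hc.memLp_of_hasCompactSupport (hasCompactSupport_of_eq_zero_off_closedBall hf)

/-- The dilation has Jacobian s³; the resulting factor s^{-3/2} in L² is the source of every decay
rate in s below. -/
theorem memLp_two_comp_affine {F : E3 → ℝ} (hFc : Continuous F) (hF : MemLp F 2 volume) (x : E3)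
    {s : ℝ} (hs : 0 < s) :
    MemLp (fun y => F (x + s • y)) 2 volume ∧
      √(∫ y, F (x + s • y) ^ 2) = √(∫ y, F y ^ 2) / √(s ^ 3) := by
  have hi : Integrable (fun y => F y ^ 2) := (memLp_two_iff_integrable_sq hF.1).1 hF
  constructor
  · rw [memLp_two_iff_integrable_sq (by fun_prop)]
    exact (hi.comp_add_left x).comp_smul hs.ne'
  · have h := Measure.integral_comp_smul volume (fun z => F (x + z) ^ 2) s
    rw [h, integral_add_left_eq_self (fun z => F z ^ 2) x]
    have h3 : Module.finrank ℝ E3 = 3 := by simp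
    rw [h3, abs_of_pos (by positivity), smul_eq_mul, Real.sqrt_mul (by positivity),
      Real.sqrt_inv]
    ring

theorem abs_integral_mul_comp_affine_le {F g w : E3 → ℝ}
    (hFc : Continuous F) (hF : MemLp F 2 volume) (hw : Continuous w)
    (hw0 : ∀ y ∉ Metric.closedBall (0 : E3) 1, w y = 0) (x : E3) {s : ℝ} (hs : 0 < s)
    (hg : ∀ y, |g y| ≤ |w y| * |F (x + s • y)|) :
    |∫ y, g y| ≤ √(∫ y, w y ^ 2) * √(∫ y, F y ^ 2) / √(s ^ 3) := by
  obtain ⟨h1, h2⟩ := memLp_two_comp_affine hFc hF x hs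
  have hwL := continuous_memLp_two hw hw0
  calc |∫ y, g y| ≤ ∫ y, |w y| * |F (x + s • y)| := by
        have hi : Integrable (fun y => |w y| * |F (x + s • y)|) :=
          MemLp.integrable_mul hwL.abs h1.abs
        exact norm_integral_le_of_norm_le (f := g) hi (Filter.Eventually.of_forall hg)
    _ ≤ _ := by
        refine (integral_abs_mul_le_sqrt_mul_sqrt hwL h1).trans_eq ?_
        rw [h2, mul_div_assoc]

/-- The weighted average of `v` over the ball of radius `s` centred at `x`. -/
noncomputable def avg (v : E3 → ℝ) (x : E3) (s : ℝ) : ℝ := ∫ y, weight y * v (x + s • y)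

theorem hasDerivAt_integral_weight_mul {v : E3 → ℝ} (hv : ContDiff ℝ 1 v) (c₀ c₁ : E3)
    (s₀ s₁ l : ℝ) :
    HasDerivAt (fun l : ℝ => ∫ y, weight y * v (c₀ + l • c₁ + (s₀ + l * s₁) • y))
      (∫ y, weight y * fderiv ℝ v (c₀ + l • c₁ + (s₀ + l * s₁) • y) (c₁ + s₁ • y)) l := by
  have hw := continuous_weight
  have hvc := hv.continuous
  have hv' : Continuous (fderiv ℝ v) := hv.continuous_fderiv one_ne_zero
  refine hasDerivAt_integral_of_continuous_of_compact (K := Metric.closedBall (0 : E3) 1)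
    (F := fun l y => weight y * v (c₀ + l • c₁ + (s₀ + l * s₁) • y))
    (F' := fun l y => weight y * fderiv ℝ v (c₀ + l • c₁ + (s₀ + l * s₁) • y) (c₁ + s₁ • y))
    (isCompact_closedBall 0 1) measurableSet_closedBall ?_ ?_ ?_ ?_ ?_ l
  · simp only [Function.uncurry_def]; fun_prop
  · simp only [Function.uncurry_def]; fun_prop
  · intro l y hy; simp [weight_eq_zero hy]
  · intro l y hy; simp [weight_eq_zero hy]
  · intro l y
    have h1 : HasDerivAt (fun l : ℝ => c₀ + l • c₁ + (s₀ + l * s₁) • y) (c₁ + s₁ • y) l := by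
      have ha := ((hasDerivAt_id l).smul_const c₁).const_add c₀
      have hb := (((hasDerivAt_id l).mul_const s₁).const_add s₀).smul_const y
      convert! ha.add hb using 1
      simp
    exact (((hv.differentiable one_ne_zero _).hasFDerivAt).comp_hasDerivAt l h1).const_mul _

theorem avg_zero (v : E3 → ℝ) (x : E3) : avg v x 0 = 4 * Real.pi * (128 / 315) * v x := by
  simp [avg, integral_mul_const, integral_weight]

theorem hasDerivAt_avg {v : E3 → ℝ} (hv : ContDiff ℝ 1 v) (x : E3) (s : ℝ) :
    HasDerivAt (avg v x) (∫ y, weight y * fderiv ℝ v (x + s • y) y) s := by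
  have h := hasDerivAt_integral_weight_mul hv x 0 0 1 s
  simp only [smul_zero, add_zero, zero_add, mul_one, one_smul] at h
  exact h

/-- Since weight(y) y = −∇bump(y), integrating by parts turns the radial derivative of v into a
Laplacian. The chain rule supplies the factor s, which improves the rate s^{-3/2} to s^{-1/2},
integrable at s = 0. -/
theorem integral_weight_mul_fderiv {v : E3 → ℝ} (hv : ContDiff ℝ 2 v) (x : E3) (s : ℝ) :
    ∫ y, weight y * fderiv ℝ v (x + s • y) y = ∫ y, s * (bump y *
      ∑ i : Fin 3, fderiv ℝ (fun z => fderiv ℝ v z (EuclideanSpace.single i 1)) (x + s • y)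
        (EuclideanSpace.single i 1)) := by
  have hg : ∀ i : Fin 3, ContDiff ℝ 1 (fun z => fderiv ℝ v z (EuclideanSpace.single i 1)) :=
    fun i => (hv.fderiv_right (m := 1) (by norm_num)).clm_apply contDiff_const
  set g : Fin 3 → E3 → ℝ := fun i z => fderiv ℝ v z (EuclideanSpace.single i 1) with hgdef
  set g' : Fin 3 → E3 → ℝ := fun i z => fderiv ℝ (g i) z (EuclideanSpace.single i 1) with hg'def
  have hgc : ∀ i, Continuous (g i) := fun i => (hg i).continuous
  have hg'c : ∀ i, Continuous (g' i) := fun i =>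
    ((hg i).continuous_fderiv one_ne_zero).clm_apply continuous_const
  have hw := continuous_weight
  have hb := continuous_bump
  have hint : ∀ f : E3 → ℝ, Continuous f → (∀ y ∉ Metric.closedBall (0 : E3) 1, f y = 0) →
      Integrable f := fun f hf h0 =>
    hf.integrable_of_hasCompactSupport (hasCompactSupport_of_eq_zero_off_closedBall h0)
  have key : ∀ i, ∫ y, weight y * y i * g i (x + s • y) = ∫ y, s * (bump y * g' i (x + s • y)) := by
    intro i
    have hd : ∀ y, HasFDerivAt (fun y => g i (x + s • y)) (s • fderiv ℝ (g i) (x + s • y)) y := by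
      intro y
      have h1 : HasFDerivAt (fun y : E3 => x + s • y) (s • ContinuousLinearMap.id ℝ E3) y :=
        ((hasFDerivAt_id y).const_smul s).const_add x
      have := ((hg i).differentiable one_ne_zero (x + s • y)).hasFDerivAt.comp y h1
      refine this.congr_fderiv ?_
      ext w
      simp [g]
    have hi := integral_mul_fderiv_eq_neg_fderiv_mul_of_integrable (μ := (volume : Measure E3))
      (f := bump) (g := fun y => g i (x + s • y)) (v := EuclideanSpace.single i (1 : ℝ))
      (by
        refine hint _ ?_ fun y hy => ?_
        · simp only [(hasFDerivAt_bump _).fderiv]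
          simp only [_root_.smul_apply, innerSL_apply_apply]
          fun_prop
        · simp [(hasFDerivAt_bump _).fderiv, weight_eq_zero hy])
      (by
        refine hint _ ?_ fun y hy => by simp [bump_eq_zero hy]
        simp only [(hd _).fderiv]
        have := hg'c i
        exact hb.mul (((this.comp (by fun_prop : Continuous fun y : E3 => x + s • y))).const_smul s))
      (hint _ (by fun_prop) fun y hy => by simp [bump_eq_zero hy])
      (fun y _ => (hasFDerivAt_bump y).differentiableAt) (fun y _ => (hd y).differentiableAt)
    simp only [(hd _).fderiv, (hasFDerivAt_bump _).fderiv] at hi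
    rw [← integral_neg] at hi
    calc _ = _ := integral_congr_ae (Filter.Eventually.of_forall fun y => ?_)
      _ = _ := hi.symm
      _ = _ := integral_congr_ae (Filter.Eventually.of_forall fun y => ?_)
    · simp [EuclideanSpace.inner_single_right]
    · simp [g', mul_left_comm]
  have h1 : ∀ y, weight y * fderiv ℝ v (x + s • y) y
      = ∑ i, weight y * y i * g i (x + s • y) := by
    intro y
    rw [sum_coord_mul_eq, Finset.mul_sum]
    exact Finset.sum_congr rfl fun i _ => by simp [g, mul_assoc]
  simp only [h1, Finset.mul_sum]
  rw [integral_finsetSum, integral_finsetSum]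
  · exact Finset.sum_congr rfl fun i _ => key i
  · intro i _
    have := hg'c i
    exact hint _ (by fun_prop) fun y hy => by simp [bump_eq_zero hy]
  · intro i _
    exact hint _ (by fun_prop) fun y hy => by simp [weight_eq_zero hy]

/-- The rate s^{-3/2}, integrable at infinity: this one serves at large scales. -/
theorem abs_deriv_avg_le_of_gradient {v F : E3 → ℝ} (hFc : Continuous F) (hF : MemLp F 2 volume)
    (hvF : ∀ z w, |fderiv ℝ v z w| ≤ |F z| * ‖w‖) (x : E3) {s : ℝ} (hs : 0 < s) :
    |∫ y, weight y * fderiv ℝ v (x + s • y) y|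
      ≤ √(4 * Real.pi * (65536 / 255255)) * √(∫ y, F y ^ 2) / √(s ^ 3) := by
  rw [← integral_weight_mul_norm_sq]
  have hw := continuous_weight
  refine abs_integral_mul_comp_affine_le (w := fun y => weight y * ‖y‖) hFc hF (by fun_prop)
    (fun y hy => by simp [weight_eq_zero hy]) x hs fun y => ?_
  rw [abs_mul, abs_mul, abs_norm, mul_assoc]
  refine mul_le_mul_of_nonneg_left ?_ (abs_nonneg _)
  rw [mul_comm]
  exact hvF _ _

theorem abs_deriv_avg_le_of_laplacian {v H : E3 → ℝ} (hv : ContDiff ℝ 2 v) (hHc : Continuous H)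
    (hH : MemLp H 2 volume)
    (hvH : ∀ z, |∑ i : Fin 3, fderiv ℝ (fun z => fderiv ℝ v z (EuclideanSpace.single i 1)) z
        (EuclideanSpace.single i 1)| ≤ |H z|) (x : E3) {s : ℝ} (hs : 0 < s) :
    |∫ y, weight y * fderiv ℝ v (x + s • y) y|
      ≤ s * (√(4 * Real.pi * (32768 / 2078505)) * √(∫ y, H y ^ 2) / √(s ^ 3)) := by
  rw [integral_weight_mul_fderiv hv, integral_const_mul, abs_mul, abs_of_pos hs,
    ← integral_bump_sq]
  refine mul_le_mul_of_nonneg_left ?_ hs.le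
  refine abs_integral_mul_comp_affine_le hHc hH continuous_bump
    (fun y hy => bump_eq_zero hy) x hs fun y => ?_
  rw [abs_mul]
  exact mul_le_mul_of_nonneg_left (hvH _) (abs_nonneg _)

/-- If `A` has a derivative of size at most `a s^{-1/2}` and at most `b s^{-3/2}`, then `A` varies
by at most `2 a σ + 2 b / σ` on `[0, ∞)`. -/
theorem abs_sub_le_of_abs_deriv_le {A A' : ℝ → ℝ} {a b : ℝ} (hA : ∀ s, HasDerivAt A (A' s) s)
    (ha : ∀ s, 0 < s → |A' (s ^ 2)| ≤ a / s) (hb : ∀ s, 0 < s → |A' (s ^ 2)| ≤ b / s ^ 3)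
    {σ τ : ℝ} (hσ : 0 < σ) (hτ : σ ≤ τ) :
    |A (τ ^ 2) - A 0| ≤ 2 * a * σ + 2 * b / σ := by
  have ha0 : 0 ≤ a := by
    have := (abs_nonneg _).trans (ha 1 one_pos); simpa using this
  have hb0 : 0 ≤ b := by
    have := (abs_nonneg _).trans (hb 1 one_pos); simpa using this
  -- In the variable s with scale s², the factor 2s from the chain rule cancels the 1/s of the
  -- bound, so the derivative is at most the constant 2a and the mean value inequality applies up to
  -- s = 0.
  have h1 : |A (σ ^ 2) - A 0| ≤ 2 * a * σ := by
    have hd : ∀ s ∈ Icc 0 σ, HasDerivWithinAt (fun s => A (s ^ 2)) (A' (s ^ 2) * (2 * s))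
        (Icc 0 σ) s := by
      intro s _
      have := (hA (s ^ 2)).comp s (hasDerivAt_pow 2 s)
      convert! this.hasDerivWithinAt using 1
      simp
    have := norm_image_sub_le_of_norm_deriv_le_segment' hd (C := 2 * a) (fun s hs => ?_) σ
      (right_mem_Icc.2 hσ.le)
    · simpa using this
    · rcases hs.1.eq_or_lt with h | h
      · subst h; simpa using ha0
      · rw [Real.norm_eq_abs, abs_mul, abs_of_pos (by positivity : (0 : ℝ) < 2 * s)]
        have := ha s h
        rw [le_div_iff₀ h] at this
        linarith
  have h2 : |A (τ ^ 2) - A (σ ^ 2)| ≤ 2 * b / σ := by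
    have hτ0 : 0 < τ := hσ.trans_le hτ
    have hle : 1 / τ ≤ 1 / σ := one_div_le_one_div_of_le hσ hτ
    have hpos : 0 < 1 / τ := by positivity
    -- At large scales the substitution is scale = s^{-2}: the bound b s^{-3} again becomes a
    -- constant, here 2b, on an interval of length at most 1/σ.
    have hd : ∀ s ∈ Icc (1 / τ) (1 / σ), HasDerivWithinAt (fun s => A ((s⁻¹) ^ 2))
        (A' ((s⁻¹) ^ 2) * (2 * s⁻¹ * (-(s ^ 2)⁻¹))) (Icc (1 / τ) (1 / σ)) s := by
      intro s hs
      have hs0 : s ≠ 0 := (hpos.trans_le hs.1).ne'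
      have := (hA (s⁻¹ ^ 2)).comp s ((hasDerivAt_inv hs0).pow 2)
      convert! this.hasDerivWithinAt using 1
      simp
    have := norm_image_sub_le_of_norm_deriv_le_segment' hd (C := 2 * b) (fun s hs => ?_) (1 / σ)
      (right_mem_Icc.2 hle)
    · have h3 : 2 * b * (1 / σ - 1 / τ) ≤ 2 * b / σ := by
        rw [mul_sub, mul_one_div]
        have : 0 ≤ 2 * b * (1 / τ) := by positivity
        linarith
      rw [abs_sub_comm]
      simpa using this.trans h3
    · have h : 0 < s := hpos.trans_le hs.1
      have := hb s⁻¹ (by positivity)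
      rw [inv_pow s 3, div_inv_eq_mul] at this
      rw [Real.norm_eq_abs, abs_mul, mul_neg, abs_neg,
        abs_of_pos (by positivity : 0 < 2 * s⁻¹ * (s ^ 2)⁻¹)]
      calc _ ≤ b * s ^ 3 * (2 * s⁻¹ * (s ^ 2)⁻¹) :=
            mul_le_mul_of_nonneg_right this (by positivity)
        _ = 2 * b := by field_simp
  calc |A (τ ^ 2) - A 0| = |(A (τ ^ 2) - A (σ ^ 2)) + (A (σ ^ 2) - A 0)| := by ring_nf
    _ ≤ _ := (abs_add_le _ _).trans (by linarith)

/-- Moving the centre along the segment from x to y costs only s^{-3/2}, so the averages about any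
two points merge as s → ∞. This is why differences of v are controlled with no assumption on v at
infinity. -/
theorem abs_avg_sub_avg_le {v F : E3 → ℝ} (hv : ContDiff ℝ 1 v) (hFc : Continuous F)
    (hF : MemLp F 2 volume) (hvF : ∀ z w, |fderiv ℝ v z w| ≤ |F z| * ‖w‖) (x y : E3) {s : ℝ}
    (hs : 0 < s) :
    |avg v y s - avg v x s| ≤
      √(∫ z, (weight z * ‖y - x‖) ^ 2) * √(∫ z, F z ^ 2) / √(s ^ 3) := by
  have hw := continuous_weight
  have hd : ∀ l ∈ Icc (0 : ℝ) 1, HasDerivWithinAt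
      (fun l : ℝ => ∫ z, weight z * v (x + l • (y - x) + s • z))
      (∫ z, weight z * fderiv ℝ v (x + l • (y - x) + s • z) (y - x)) (Icc 0 1) l := by
    intro l _
    simpa using (hasDerivAt_integral_weight_mul hv x (y - x) s 0 l).hasDerivWithinAt
  have := norm_image_sub_le_of_norm_deriv_le_segment' hd
    (C := √(∫ z, (weight z * ‖y - x‖) ^ 2) * √(∫ z, F z ^ 2) / √(s ^ 3)) (fun l hl => ?_) 1
    (right_mem_Icc.2 zero_le_one)
  · simpa [avg] using this
  · refine abs_integral_mul_comp_affine_le (w := fun z => weight z * ‖y - x‖) hFc hF (by fun_prop)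
      (fun z hz => by simp [weight_eq_zero hz]) (x + l • (y - x)) hs fun z => ?_
    rw [abs_mul, abs_mul, abs_norm, mul_assoc]
    refine mul_le_mul_of_nonneg_left ?_ (abs_nonneg _)
    rw [mul_comm]
    exact hvF _ _

/-- Agmon-type inequality: the oscillation of `v` on `ℝ³` is controlled by
`‖∇v‖_{L²}^{1/2} ‖Δv‖_{L²}^{1/2}`. -/
theorem abs_sub_le_sqrt_gradient_laplacian {v F H : E3 → ℝ} (hv : ContDiff ℝ 2 v)
    (hFc : Continuous F) (hF : MemLp F 2 volume) (hHc : Continuous H) (hH : MemLp H 2 volume)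
    (hvF : ∀ z w, |fderiv ℝ v z w| ≤ |F z| * ‖w‖)
    (hvH : ∀ z, |∑ i : Fin 3, fderiv ℝ (fun z => fderiv ℝ v z (EuclideanSpace.single i 1)) z
        (EuclideanSpace.single i 1)| ≤ |H z|) (x y : E3) :
    |v x - v y| ≤ √2 * √(√(∫ z, F z ^ 2) * √(∫ z, H z ^ 2)) := by
  have hv1 : ContDiff ℝ 1 v := hv.of_le (by norm_num)
  set NF := √(∫ z, F z ^ 2)
  set NH := √(∫ z, H z ^ 2)
  have hNF : 0 ≤ NF := Real.sqrt_nonneg _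
  have hNH : 0 ≤ NH := Real.sqrt_nonneg _
  set a := √(4 * Real.pi * (32768 / 2078505)) * NH with ha
  set b := √(4 * Real.pi * (65536 / 255255)) * NF with hb
  set I := 4 * Real.pi * (128 / 315) with hI
  have hsq : ∀ s : ℝ, 0 < s → √((s ^ 2) ^ 3) = s ^ 3 := fun s hs => by
    rw [show (s ^ 2) ^ 3 = (s ^ 3) ^ 2 by ring, Real.sqrt_sq (by positivity)]
  have hA : ∀ x : E3, ∀ σ τ : ℝ, 0 < σ → σ ≤ τ →
      |avg v x (τ ^ 2) - I * v x| ≤ 2 * a * σ + 2 * b / σ := by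
    intro x σ τ hσ hτ
    rw [hI, ← avg_zero]
    refine abs_sub_le_of_abs_deriv_le (hasDerivAt_avg hv1 x) (fun s hs => ?_) (fun s hs => ?_) hσ hτ
    · have := abs_deriv_avg_le_of_laplacian hv hHc hH hvH x (s := s ^ 2) (by positivity)
      rw [hsq s hs] at this
      refine this.trans_eq ?_
      rw [ha]
      field_simp
      rfl
    · have := abs_deriv_avg_le_of_gradient hFc hF hvF x (s := s ^ 2) (by positivity)
      rwa [hsq s hs] at this
  have hlim : ∀ σ : ℝ, 0 < σ → I * |v x - v y| ≤ (4 * a) * σ + (4 * b) / σ := by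
    intro σ hσ
    set D := √(∫ z, (weight z * ‖y - x‖) ^ 2) * NF
    -- Go from v x to its average at scale τ², across to the average about y, and back to v y. Each
    -- vertical leg costs 2aσ + 2b/σ, and the crossing costs D/τ³, which disappears as τ → ∞.
    have h1 : ∀ τ : ℝ, σ ≤ τ → I * |v x - v y| ≤ ((4 * a) * σ + (4 * b) / σ) + D / τ ^ 3 := by
      intro τ hτ
      have hτ0 := hσ.trans_le hτ
      have e1 := hA x σ τ hσ hτ
      have e2 := hA y σ τ hσ hτ
      have e3 := abs_avg_sub_avg_le hv1 hFc hF hvF x y (s := τ ^ 2) (by positivity)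
      rw [hsq τ hτ0] at e3
      have hI0 : 0 < I := by positivity
      rw [show I * |v x - v y| = |I * (v x - v y)| by rw [abs_mul, abs_of_pos hI0]]
      have e4 : 2 * b / σ = 2 * (b / σ) := by ring
      have e5 : 4 * b / σ = 4 * (b / σ) := by ring
      rw [e4] at e1 e2
      rw [e5]
      rw [abs_le] at e1 e2 e3 ⊢
      constructor <;> linarith [e1.1, e1.2, e2.1, e2.2, e3.1, e3.2]
    have h2 : Filter.Tendsto (fun τ : ℝ => ((4 * a) * σ + (4 * b) / σ) + D / τ ^ 3) Filter.atTop
        (𝓝 (((4 * a) * σ + (4 * b) / σ) + 0)) :=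
      tendsto_const_nhds.add (tendsto_const_nhds.div_atTop
        (Filter.tendsto_pow_atTop (by norm_num)))
    rw [add_zero] at h2
    exact ge_of_tendsto h2 (Filter.eventually_atTop.2 ⟨σ, h1⟩)
  have hfin := le_two_mul_sqrt_of_forall_le (by positivity) (by positivity) hlim
  have hI0 : 0 < I := by positivity
  rw [← mul_le_mul_iff_right₀ hI0]
  refine hfin.trans ?_
  rw [← Real.sqrt_mul (by norm_num)]
  refine (sq_le_sq₀ (by positivity) (by positivity)).1 ?_
  rw [mul_pow, mul_pow, Real.sq_sqrt (by positivity), Real.sq_sqrt (by positivity)]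
  have hpi := Real.pi_gt_d2
  -- Optimising in σ gives 8√(ab), which has to be at most √2 I √(NF·NH). After squaring, this is
  -- the present numerical inequality, the point where the profile of the bump enters: roughly 25.6
  -- ≤ 26.1. Squared once more it says that π² is at least about 9.5, so bounding π below by 3 would
  -- not do.
  have hc : 32 * (√(4 * Real.pi * (32768 / 2078505)) * √(4 * Real.pi * (65536 / 255255)))
      ≤ I ^ 2 := by
    rw [← Real.sqrt_mul (by positivity)]
    refine (sq_le_sq₀ (by positivity) (by positivity)).1 ?_
    rw [mul_pow, Real.sq_sqrt (by positivity), hI]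
    have h2 : (3.14 : ℝ) ^ 2 ≤ Real.pi ^ 2 := by gcongr
    have h4 : 0 < Real.pi ^ 2 := by positivity
    nlinarith
  have := mul_le_mul_of_nonneg_right hc (by positivity : 0 ≤ 2 * (NF * NH))
  calc _ = 32 * (√(4 * Real.pi * (32768 / 2078505)) * √(4 * Real.pi * (65536 / 255255)))
        * (2 * (NF * NH)) := by rw [ha, hb]; ring
    _ ≤ _ := this

/-! ### The vertical component of a divergence-free field -/

theorem eLpNorm_two_eq_ofReal_sqrt {α : Type*} [MeasurableSpace α] {μ : Measure α} {f : α → ℝ}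
    (hf : MemLp f 2 μ) : eLpNorm f 2 μ = ENNReal.ofReal √(∫ x, f x ^ 2 ∂μ) := by
  rw [hf.eLpNorm_eq_integral_rpow_norm (by norm_num) (by norm_num), Real.sqrt_eq_rpow]
  simp

theorem pd_apply {v : E3 → E3} {x : E3} (hv : DifferentiableAt ℝ v x) (i j : Fin 3) :
    fderiv ℝ (fun z => v z j) x (EuclideanSpace.single i 1) = pd i v x j := by
  have h := (EuclideanSpace.proj j : E3 →L[ℝ] ℝ).hasFDerivAt.comp x
    hv.hasFDerivAt
  rw [show (fun z => v z j) = (EuclideanSpace.proj j : E3 →L[ℝ] ℝ) ∘ v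
    from rfl, h.fderiv]
  rfl

theorem contDiff_pd {v : E3 → E3} {n : WithTop ℕ∞} (hv : ContDiff ℝ (n + 1) v) (i : Fin 3) :
    ContDiff ℝ n (pd i v) :=
  (hv.fderiv_right le_rfl).clm_apply contDiff_const

theorem contDiff_coord {v : E3 → E3} {n : WithTop ℕ∞} (hv : ContDiff ℝ n v) (j : Fin 3) :
    ContDiff ℝ n (fun z => v z j) :=
  (EuclideanSpace.proj j : E3 →L[ℝ] ℝ).contDiff.comp hv

theorem continuous_hGrad {v : E3 → E3} (hv : ContDiff ℝ 1 v) : Continuous (hGrad v) := by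
  have h : ∀ i, Continuous (pd i v) := fun i => (contDiff_pd (n := 0) hv i).continuous
  have h0 := h 0
  have h1 := h 1
  unfold hGrad
  fun_prop

theorem contDiff_curl {v : E3 → E3} {n : WithTop ℕ∞} (hv : ContDiff ℝ (n + 1) v) :
    ContDiff ℝ n (curl v) := by
  have h : ∀ i j, ContDiff ℝ n (fun z => pd i v z j) := fun i j =>
    contDiff_coord (contDiff_pd hv i) j
  rw [contDiff_euclidean]
  intro i
  fin_cases i
  · exact (h 1 2).sub (h 2 1)
  · exact (h 2 0).sub (h 0 2)
  · exact (h 0 1).sub (h 1 0)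

theorem hGrad_sq (v : E3 → E3) (x : E3) :
    hGrad v x ^ 2 = pd 0 v x 0 ^ 2 + pd 0 v x 1 ^ 2 + pd 0 v x 2 ^ 2
      + (pd 1 v x 0 ^ 2 + pd 1 v x 1 ^ 2 + pd 1 v x 2 ^ 2) := by
  rw [hGrad, Real.sq_sqrt (by positivity), EuclideanSpace.real_norm_sq_eq,
    EuclideanSpace.real_norm_sq_eq]
  simp [Fin.sum_univ_three]

/-- The gradient of the vertical component is controlled by the horizontal gradient. -/
theorem abs_fderiv_vertical_le {v : E3 → E3} (hv : Differentiable ℝ v) (hdiv : ∀ x, div v x = 0)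
    (z w : E3) : |fderiv ℝ (fun z => v z 2) z w| ≤ |√2 * hGrad v z| * ‖w‖ := by
  rw [sum_coord_mul_eq]
  simp only [pd_apply (hv z)]
  have hd := hdiv z
  have hs := hGrad_sq v z
  simp only [div, Fin.sum_univ_three] at hd ⊢
  have hw : ‖w‖ ^ 2 = w 0 ^ 2 + w 1 ^ 2 + w 2 ^ 2 := by
    rw [EuclideanSpace.real_norm_sq_eq, Fin.sum_univ_three]
  refine abs_le_of_sq_le_sq ?_ (by positivity)
  rw [mul_pow, sq_abs, mul_pow, Real.sq_sqrt (by norm_num), hs, hw]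
  -- Incompressibility trades the only vertical derivative that is not part of ∇_h v.
  have e : pd 2 v z 2 = -(pd 0 v z 0 + pd 1 v z 1) := by linarith
  rw [e]
  have hcs : (w 0 * pd 0 v z 2 + w 1 * pd 1 v z 2 + w 2 * -(pd 0 v z 0 + pd 1 v z 1)) ^ 2
      ≤ (w 0 ^ 2 + w 1 ^ 2 + w 2 ^ 2) *
        (pd 0 v z 2 ^ 2 + pd 1 v z 2 ^ 2 + (pd 0 v z 0 + pd 1 v z 1) ^ 2) := by
    nlinarith [sq_nonneg (w 0 * pd 1 v z 2 - w 1 * pd 0 v z 2),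
      sq_nonneg (w 0 * (pd 0 v z 0 + pd 1 v z 1) + w 2 * pd 0 v z 2),
      sq_nonneg (w 1 * (pd 0 v z 0 + pd 1 v z 1) + w 2 * pd 1 v z 2)]
  refine hcs.trans ?_
  rw [mul_comm]
  refine mul_le_mul_of_nonneg_right ?_ (by positivity)
  -- The factor 2 is spent on (∂₁v₁ + ∂₂v₂)² ≤ 2((∂₁v₁)² + (∂₂v₂)²).
  nlinarith [sq_nonneg (pd 0 v z 0 - pd 1 v z 1), sq_nonneg (pd 0 v z 1), sq_nonneg (pd 1 v z 0),
    sq_nonneg (pd 0 v z 2), sq_nonneg (pd 1 v z 2)]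

theorem pd_comm {v : E3 → E3} (hv : ContDiff ℝ 2 v) (i j : Fin 3) (x : E3) :
    pd i (pd j v) x = pd j (pd i v) x := by
  have h : ∀ i j, pd i (pd j v) x
      = fderiv ℝ (fderiv ℝ v) x (EuclideanSpace.single i 1) (EuclideanSpace.single j 1) := by
    intro i j
    have hd : DifferentiableAt ℝ (fderiv ℝ v) x :=
      ((hv.fderiv_right (m := 1) (by norm_num)).differentiable one_ne_zero) x
    have := hd.hasFDerivAt.clm_apply (hasFDerivAt_const (EuclideanSpace.single j (1 : ℝ)) x)
    rw [pd, show pd j v = fun y => fderiv ℝ v y (EuclideanSpace.single j 1) from rfl, this.fderiv]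
    simp
  rw [h, h]
  exact (hv.contDiffAt.isSymmSndFDerivAt (by simp)).eq _ _

/-- The Laplacian of the vertical component of a divergence-free field is the vertical component
of minus the curl of its curl, and is controlled by the horizontal gradient of the curl. -/
theorem abs_laplacian_vertical_le {v : E3 → E3} (hv : ContDiff ℝ 2 v) (hdiv : ∀ x, div v x = 0)
    (z : E3) :
    |∑ i : Fin 3, fderiv ℝ (fun z => fderiv ℝ (fun z => v z 2) z (EuclideanSpace.single i 1)) z
        (EuclideanSpace.single i 1)| ≤ |√2 * hGrad (curl v) z| := by
  have hd : Differentiable ℝ v := hv.differentiable (by norm_num)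
  have hpd : ∀ i, Differentiable ℝ (pd i v) := fun i =>
    (contDiff_pd (n := 1) (hv.of_le one_add_one_eq_two.le) i).differentiable one_ne_zero
  simp only [pd_apply (hd _), pd_apply (hpd _ _)]
  have hlin : ∀ a b c d : Fin 3, ∀ k : Fin 3,
      fderiv ℝ (fun z => pd a v z b - pd c v z d) z (EuclideanSpace.single k 1)
        = pd k (pd a v) z b - pd k (pd c v) z d := by
    intro a b c d k
    have h1 : DifferentiableAt ℝ (fun z => pd a v z b) z :=
      ((contDiff_coord (contDiff_pd (n := 1) (hv.of_le one_add_one_eq_two.le) a) b).differentiable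
        one_ne_zero) z
    have h2 : DifferentiableAt ℝ (fun z => pd c v z d) z :=
      ((contDiff_coord (contDiff_pd (n := 1) (hv.of_le one_add_one_eq_two.le) c) d).differentiable
        one_ne_zero) z
    rw [← pd_apply (hpd _ _), ← pd_apply (hpd _ _), fderiv_fun_sub h1 h2]
    rfl
  have hcurl : Differentiable ℝ (curl v) :=
    (contDiff_curl (n := 1) (hv.of_le one_add_one_eq_two.le)).differentiable one_ne_zero
  have e1 : pd 0 (curl v) z 1 = pd 0 (pd 2 v) z 0 - pd 0 (pd 0 v) z 2 := by
    rw [← pd_apply (hcurl z)]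
    exact hlin 2 0 0 2 0
  have e0 : pd 1 (curl v) z 0 = pd 1 (pd 1 v) z 2 - pd 1 (pd 2 v) z 1 := by
    rw [← pd_apply (hcurl z)]
    exact hlin 1 2 2 1 1
  have ediv : pd 2 (pd 0 v) z 0 + pd 2 (pd 1 v) z 1 + pd 2 (pd 2 v) z 2 = 0 := by
    have h : fderiv ℝ (div v) z (EuclideanSpace.single 2 1) = 0 := by
      rw [show div v = fun _ => 0 from funext hdiv]; simp
    have h1 : ∀ a b : Fin 3, DifferentiableAt ℝ (fun z => pd a v z b) z := fun a b =>
      ((contDiff_coord (contDiff_pd (n := 1) (hv.of_le one_add_one_eq_two.le) a) b).differentiable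
        one_ne_zero) z
    rw [show div v = fun z => pd 0 v z 0 + pd 1 v z 1 + pd 2 v z 2 from
      funext fun z => by simp [div, Fin.sum_univ_three],
      fderiv_fun_add ((h1 0 0).fun_add (h1 1 1)) (h1 2 2), fderiv_fun_add (h1 0 0) (h1 1 1)] at h
    rw [← pd_apply (hpd _ _), ← pd_apply (hpd _ _), ← pd_apply (hpd _ _)]
    exact h
  rw [Fin.sum_univ_three]
  have hs := hGrad_sq (curl v) z
  have e : pd 0 (pd 0 v) z 2 + pd 1 (pd 1 v) z 2 + pd 2 (pd 2 v) z 2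
      = pd 1 (curl v) z 0 - pd 0 (curl v) z 1 := by
    rw [e0, e1, pd_comm hv 0 2, pd_comm hv 1 2]
    linarith
  rw [e]
  refine sq_le_sq.1 ?_
  rw [mul_pow, Real.sq_sqrt (by norm_num), hs]
  nlinarith [sq_nonneg (pd 1 (curl v) z 0 + pd 0 (curl v) z 1), sq_nonneg (pd 0 (curl v) z 0),
    sq_nonneg (pd 0 (curl v) z 2), sq_nonneg (pd 1 (curl v) z 1), sq_nonneg (pd 1 (curl v) z 2)]

/-- The oscillation of the vertical component of a divergence-free field. -/
theorem enorm_vertical_sub_le {v : E3 → E3} (hv : ContDiff ℝ 2 v) (hdiv : ∀ x, div v x = 0)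
    (h1 : MemLp (hGrad v) 2 volume) (h2 : MemLp (hGrad (curl v)) 2 volume) (x y : E3) :
    ‖v x 2 - v y 2‖ₑ ≤ 2 * (eLpNorm (hGrad v) 2 volume ^ (1 / 2 : ℝ) *
      eLpNorm (hGrad (curl v)) 2 volume ^ (1 / 2 : ℝ)) := by
  have hc1 := continuous_hGrad (hv.of_le (by norm_num))
  have hc2 := continuous_hGrad (contDiff_curl (n := 1) (v := v) (hv.of_le one_add_one_eq_two.le))
  have h := abs_sub_le_sqrt_gradient_laplacian (contDiff_coord hv 2)
    (F := fun z => √2 * hGrad v z) (H := fun z => √2 * hGrad (curl v) z) (by fun_prop)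
    (h1.const_mul _) (by fun_prop) (h2.const_mul _)
    (abs_fderiv_vertical_le (hv.differentiable (by norm_num)) hdiv)
    (abs_laplacian_vertical_le hv hdiv) x y
  have hs : ∀ f : E3 → ℝ, √(∫ z, (√2 * f z) ^ 2) = √2 * √(∫ z, f z ^ 2) := by
    intro f
    simp only [mul_pow]
    rw [integral_const_mul, Real.sqrt_mul (by positivity), Real.sqrt_sq (by positivity)]
  -- The factors √2 in front of the two norms give √(√2·√2) = √2; together with the √2 of the
  -- oscillation inequality this is the constant 2.
  rw [hs, hs, show ∀ a b : ℝ, √2 * a * (√2 * b) = (√2 * √2) * (a * b) by intros; ring,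
    Real.mul_self_sqrt (by norm_num), Real.sqrt_mul (by norm_num), ← mul_assoc,
    Real.mul_self_sqrt (by norm_num), Real.sqrt_mul (by positivity)] at h
  rw [eLpNorm_two_eq_ofReal_sqrt h1, eLpNorm_two_eq_ofReal_sqrt h2,
    ENNReal.ofReal_rpow_of_nonneg (by positivity) (by norm_num),
    ENNReal.ofReal_rpow_of_nonneg (by positivity) (by norm_num), ← ENNReal.ofReal_mul
    (by positivity), ← Real.sqrt_eq_rpow, ← Real.sqrt_eq_rpow,
    Real.enorm_eq_ofReal_abs]
  refine (ENNReal.ofReal_le_ofReal h).trans_eq ?_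
  rw [ENNReal.ofReal_mul (by norm_num), ENNReal.ofReal_ofNat]

/-! ### Global flows of bounded Lipschitz fields -/

section Flow

variable {V : Type*} [NormedAddCommGroup V] [NormedSpace ℝ V]

/-- `Φ` is the global flow of the autonomous vector field `W`. -/
structure IsGlobalFlow (W : V → V) (Φ : ℝ → V → V) : Prop where
  map_zero : ∀ p, Φ 0 p = p
  hasDerivAt : ∀ p s, HasDerivAt (fun s => Φ s p) (W (Φ s p)) s

/-- A field bounded by L moves a point by at most L(n + 1) during a time n + 1, so Picard–Lindelöf
applies on each interval [−(n+1), n+1]; uniqueness glues the pieces. -/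
theorem exists_isGlobalFlow [CompleteSpace V] {W : V → V} {K L : NNReal} (hW : LipschitzWith K W)
    (hL : ∀ p, ‖W p‖ ≤ L) : ∃ Φ, IsGlobalFlow W Φ := by
  have hloc : ∀ (p : V) (n : ℕ), ∃ γ : ℝ → V, γ 0 = p ∧
      ∀ s ∈ Ioo (-(n + 1 : ℝ)) (n + 1), HasDerivAt γ (W (γ s)) s := by
    intro p n
    have h0 : (0 : ℝ) ∈ Icc (-(n + 1 : ℝ)) (n + 1) := ⟨by linarith, by positivity⟩
    have hpl : IsPicardLindelof (fun _ => W) (⟨0, h0⟩ : Icc (-(n + 1 : ℝ)) (n + 1)) p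
        (L * (n + 1)) 0 L K :=
      IsPicardLindelof.of_time_independent (fun x _ => hL x) hW.lipschitzOnWith (by simp)
    obtain ⟨γ, h1, h2⟩ := hpl.exists_eq_forall_mem_Icc_hasDerivWithinAt₀
    exact ⟨γ, h1, fun s hs => (h2 s (Ioo_subset_Icc_self hs)).hasDerivAt (Icc_mem_nhds hs.1 hs.2)⟩
  choose γ hγ0 hγ using hloc
  have hmem : ∀ s : ℝ, s ∈ Ioo (-(⌈|s|⌉₊ + 1 : ℝ)) (⌈|s|⌉₊ + 1) := fun s =>
    abs_lt.1 ((Nat.le_ceil |s|).trans_lt (lt_add_one _))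
  have heq : ∀ p (m n : ℕ), m ≤ n → EqOn (γ p n) (γ p m) (Ioo (-(m + 1 : ℝ)) (m + 1)) := by
    intro p m n hmn
    have hmn' : (m : ℝ) ≤ n := by exact_mod_cast hmn
    refine ODE_solution_unique_of_mem_Ioo (v := fun _ => W) (s := fun _ => univ) (t₀ := 0)
      (K := K) (fun _ _ => hW.lipschitzOnWith) ⟨by linarith, by positivity⟩
      (fun s hs => ⟨hγ p n s ⟨by linarith [hs.1], by linarith [hs.2]⟩, trivial⟩)
      (fun s hs => ⟨hγ p m s hs, trivial⟩) (by rw [hγ0, hγ0])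
  -- At time s use the solution of index ⌈|s|⌉, whose interval of half-length ⌈|s|⌉ + 1 has s in its
  -- interior. The index jumps with s, but neighbouring pieces agree.
  refine ⟨fun s p => γ p ⌈|s|⌉₊ s, fun p => hγ0 _ _, fun p s => ?_⟩
  have hs := hmem s
  refine (hγ p ⌈|s|⌉₊ s hs).congr_of_eventuallyEq ?_
  filter_upwards [Ioo_mem_nhds hs.1 hs.2] with s' hs'
  rcases le_total ⌈|s|⌉₊ ⌈|s'|⌉₊ with h | h
  · exact heq p _ _ h hs'
  · exact (heq p _ _ h (hmem s')).symm

namespace IsGlobalFlow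

variable {W : V → V} {Φ : ℝ → V → V} {K L : NNReal}

theorem eq_of_hasDerivAt (h : IsGlobalFlow W Φ) (hW : LipschitzWith K W) {γ : ℝ → V}
    (hγ : ∀ s, HasDerivAt γ (W (γ s)) s) (s : ℝ) : γ s = Φ s (γ 0) := by
  have := ODE_solution_unique_univ (v := fun _ => W) (s := fun _ => univ) (t₀ := 0) (K := K)
    (fun _ => hW.lipschitzOnWith) (fun s => ⟨hγ s, trivial⟩)
    (fun s => ⟨h.hasDerivAt (γ 0) s, trivial⟩) (by rw [h.map_zero])
  exact congrFun this s

theorem map_add (h : IsGlobalFlow W Φ) (hW : LipschitzWith K W) (a b : ℝ) (p : V) :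
    Φ (a + b) p = Φ a (Φ b p) := by
  have := h.eq_of_hasDerivAt hW (γ := fun s => Φ (s + b) p)
    (fun s => (h.hasDerivAt p (s + b)).comp_add_const s b) a
  simpa using this

theorem map_neg_map (h : IsGlobalFlow W Φ) (hW : LipschitzWith K W) (a : ℝ) (p : V) :
    Φ (-a) (Φ a p) = p := by
  rw [← h.map_add hW, neg_add_cancel, h.map_zero]

theorem dist_time_le (h : IsGlobalFlow W Φ) (hL : ∀ p, ‖W p‖ ≤ L) (p : V) (s s' : ℝ) :
    dist (Φ s p) (Φ s' p) ≤ L * |s - s'| := by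
  have := (convex_univ (𝕜 := ℝ) (E := ℝ)).norm_image_sub_le_of_norm_hasDerivWithin_le
    (f := fun s => Φ s p) (f' := fun s => W (Φ s p)) (C := L)
    (fun s _ => (h.hasDerivAt p s).hasDerivWithinAt) (fun s _ => hL _) (mem_univ s') (mem_univ s)
  rwa [dist_eq_norm, ← Real.norm_eq_abs]

theorem dist_le_exp (h : IsGlobalFlow W Φ) (hW : LipschitzWith K W) (p q : V) (s : ℝ) :
    dist (Φ s p) (Φ s q) ≤ dist p q * Real.exp (K * |s|) := by
  have hc : ∀ p, Continuous fun s => Φ s p := fun p =>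
    continuous_iff_continuousAt.2 fun s => (h.hasDerivAt p s).continuousAt
  rcases le_total 0 s with hs | hs
  · have := dist_le_of_trajectories_ODE (v := fun _ => W) (fun _ => hW) (hc p).continuousOn
      (fun s _ => (h.hasDerivAt p s).hasDerivWithinAt) (hc q).continuousOn
      (fun s _ => (h.hasDerivAt q s).hasDerivWithinAt) (a := 0) (b := s)
      (δ := dist p q) (by rw [h.map_zero, h.map_zero]) s (right_mem_Icc.2 hs)
    rw [abs_of_nonneg hs]
    rwa [sub_zero] at this
  · have hd : ∀ p s, HasDerivAt (fun s => Φ (-s) p) (-W (Φ (-s) p)) s := by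
      intro p s
      convert! (h.hasDerivAt p (-s)).scomp s (hasDerivAt_neg s) using 1
      simp
    have := dist_le_of_trajectories_ODE (v := fun _ p => -W p) (K := K) (fun _ => hW.neg)
      ((hc p).comp continuous_neg).continuousOn
      (fun s _ => (hd p s).hasDerivWithinAt) ((hc q).comp continuous_neg).continuousOn
      (fun s _ => (hd q s).hasDerivWithinAt) (a := 0) (b := -s)
      (δ := dist p q) (by simp [h.map_zero]) (-s) (right_mem_Icc.2 (by linarith))
    rw [abs_of_nonpos hs]
    simpa using this

/-- The error of one Euler step: W varies by at most K·L|s| along the trajectory, which makes the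
error quadratic in s. -/
theorem dist_sub_le (h : IsGlobalFlow W Φ) (hW : LipschitzWith K W) (hL : ∀ p, ‖W p‖ ≤ L)
    (p : V) (s : ℝ) : ‖Φ s p - (p + s • W p)‖ ≤ K * L * s ^ 2 := by
  have := (convex_uIcc (0 : ℝ) s).norm_image_sub_le_of_norm_hasDerivWithin_le
    (f := fun r => Φ r p - r • W p) (f' := fun r => W (Φ r p) - W p) (C := K * (L * |s|))
    (fun r _ => ((h.hasDerivAt p r).sub ?_).hasDerivWithinAt) (fun r hr => ?_)
    left_mem_uIcc right_mem_uIcc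
  · rw [sub_zero, Real.norm_eq_abs, h.map_zero, zero_smul, sub_zero] at this
    calc _ = ‖Φ s p - s • W p - p‖ := by congr 1; abel
      _ ≤ _ := this
      _ = K * L * |s| ^ 2 := by ring
      _ = _ := by rw [sq_abs]
  · simpa using (hasDerivAt_id r).smul_const (W p)
  · rw [← dist_eq_norm]
    refine (hW.dist_le_mul _ _).trans ?_
    gcongr
    have h1 := h.dist_time_le hL p r 0
    rw [h.map_zero, sub_zero] at h1
    exact h1.trans (mul_le_mul_of_nonneg_left (by simpa using abs_sub_left_of_mem_uIcc hr)
      L.coe_nonneg)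

theorem continuous_uncurry (h : IsGlobalFlow W Φ) (hW : LipschitzWith K W) (hL : ∀ p, ‖W p‖ ≤ L) :
    Continuous (Function.uncurry Φ) := by
  rw [continuous_iff_continuousAt]
  rintro ⟨s, p⟩
  rw [ContinuousAt, tendsto_iff_dist_tendsto_zero]
  have hlim : Filter.Tendsto (fun q : ℝ × V => dist q.2 p * Real.exp (K * |q.1|) + L * |q.1 - s|)
      (𝓝 (s, p)) (𝓝 0) := by
    have hc : Continuous
        (fun q : ℝ × V => dist q.2 p * Real.exp (K * |q.1|) + L * |q.1 - s|) := by fun_prop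
    simpa using hc.tendsto (s, p)
  refine squeeze_zero (fun _ => dist_nonneg) (fun q => ?_) hlim
  refine (dist_triangle _ (Φ q.1 p) _).trans ?_
  exact add_le_add (h.dist_le_exp hW _ _ _) (h.dist_time_le hL _ _ _)

theorem continuous_map (h : IsGlobalFlow W Φ) (hW : LipschitzWith K W) (hL : ∀ p, ‖W p‖ ≤ L)
    (s : ℝ) : Continuous (Φ s) :=
  (h.continuous_uncurry hW hL).comp (Continuous.prodMk_right s)

end IsGlobalFlow

end Flow

/-! ### Mollification of functions constant along a flow -/

section Mollify

variable {V : Type*} [NormedAddCommGroup V] [NormedSpace ℝ V] [FiniteDimensional ℝ V]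
  [MeasurableSpace V] [BorelSpace V] (μ : Measure V) [μ.IsAddHaarMeasure]

/-- The mollification of `φ` by the normalized bump function `η`. -/
noncomputable def mollify (η : ContDiffBump (0 : V)) (φ : V → ℝ) (p : V) : ℝ :=
  ∫ q, η.normed μ q * φ (p - q) ∂μ

variable {μ} {η : ContDiffBump (0 : V)} {φ : V → ℝ}

theorem contDiff_mollify (hφ : Continuous φ) : ContDiff ℝ ∞ (mollify μ η φ) :=
  (η.hasCompactSupport_normed (μ := μ)).contDiff_convolution_left (n := ⊤) (μ := μ)
    (ContinuousLinearMap.lsmul ℝ ℝ) η.contDiff_normed hφ.locallyIntegrable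

theorem integrable_normed_mul (hφ : Continuous φ) (p : V) :
    Integrable (fun q => η.normed μ q * φ (p - q)) μ := by
  have h1 : Continuous (η.normed μ) := (η.contDiff_normed (n := 0)).continuous
  exact Continuous.integrable_of_hasCompactSupport (by fun_prop)
    η.hasCompactSupport_normed.mul_right

theorem abs_mollify_le {p : V} {c : ℝ} (h : ∀ q, ‖q‖ < η.rOut → |φ (p - q)| ≤ c) :
    |mollify μ η φ p| ≤ c := by
  have hi : Integrable (fun q => η.normed μ q * c) μ := η.integrable_normed.mul_const c
  have h2 : ‖mollify μ η φ p‖ ≤ ∫ q, η.normed μ q * c ∂μ := by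
    refine norm_integral_le_of_norm_le hi (Filter.Eventually.of_forall fun q => ?_)
    rw [norm_mul, Real.norm_of_nonneg (η.nonneg_normed q)]
    by_cases hq : ‖q‖ < η.rOut
    · exact mul_le_mul_of_nonneg_left (h q hq) (η.nonneg_normed q)
    · have : η.normed μ q = 0 := by
        rw [← Function.notMem_support, η.support_normed_eq, mem_ball_zero_iff]
        exact hq
      simp [this]
  rwa [integral_mul_const, η.integral_normed, one_mul] at h2

theorem mollify_sub_eq (hφ : Continuous φ) (p w : V) (c : ℝ) :
    mollify μ η φ (p + w) - c * mollify μ η φ p = mollify μ η (fun q => φ (q + w) - c * φ q) p := by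
  unfold mollify
  rw [← integral_const_mul, ← integral_sub (integrable_normed_mul hφ _)
    ((integrable_normed_mul hφ _).const_mul c)]
  refine integral_congr_ae (Filter.Eventually.of_forall fun q => ?_)
  simp only [show p + w - q = p - q + w by abel]
  ring

theorem abs_mollify_sub_le (hφ : Continuous φ) {p : V} {c : ℝ}
    (h : ∀ q, ‖q‖ < η.rOut → |φ (p - q) - φ p| ≤ c) : |mollify μ η φ p - φ p| ≤ c := by
  have h1 : mollify μ η (fun q => φ q - φ p) p = mollify μ η φ p - φ p := by
    unfold mollify
    simp only [mul_sub]
    rw [integral_sub (integrable_normed_mul hφ _) (η.integrable_normed.mul_const _),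
      integral_mul_const, η.integral_normed, one_mul]
  rw [← h1]
  exact abs_mollify_le h

/-- If `φ` is constant along the flow of `W`, the derivative of its mollification along `W` is
of the order of the radius of the mollifier. -/
theorem abs_fderiv_mollify_le {W : V → V} {Φ : ℝ → V → V} {K L : NNReal} (hΦ : IsGlobalFlow W Φ)
    (hW : LipschitzWith K W) (hL : ∀ p, ‖W p‖ ≤ L) (hφ : Continuous φ)
    (hinv : ∀ s p, φ (Φ s p) = φ p) {p : V} {Λ : ℝ} (hΛ : 0 ≤ Λ)
    (hlip : ∀ q q', dist q p ≤ 1 + L → dist q' p ≤ 1 + L → |φ q - φ q'| ≤ Λ * dist q q')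
    (hη : η.rOut ≤ 1) :
    |fderiv ℝ (mollify μ η φ) p (W p)| ≤ Λ * K * (1 + L) * η.rOut := by
  have hd : HasDerivAt (fun h : ℝ => mollify μ η φ (p + h • W p))
      (fderiv ℝ (mollify μ η φ) p (W p)) 0 := by
    have h1 : HasDerivAt (fun h : ℝ => p + h • W p) (W p) 0 := by
      simpa using ((hasDerivAt_id (0 : ℝ)).smul_const (W p)).const_add p
    have h2 : HasFDerivAt (mollify μ η φ) (fderiv ℝ (mollify μ η φ) p) (p + (0 : ℝ) • W p) := by
      rw [zero_smul, add_zero]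
      exact ((contDiff_mollify (μ := μ) (η := η) hφ).differentiable (by simp) p).hasFDerivAt
    exact h2.comp_hasDerivAt 0 h1
  have hη0 := η.rOut_pos
  -- It suffices to bound the increment by a multiple of |h| for h near 0. Taking |h|(1 + L) below
  -- the radius lets the h² of the Euler error be absorbed into radius·|h|.
  refine hd.le_of_lip' (by positivity) ?_
  have hev : ∀ᶠ h : ℝ in 𝓝 0, |h| * (1 + L) ≤ η.rOut := by
    have hc : Continuous fun h : ℝ => |h| * (1 + L) := by fun_prop
    exact (hc.tendsto' 0 0 (by simp)).eventually_le_const hη0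
  filter_upwards [hev] with h hh
  have hL0 : (0 : ℝ) ≤ L := L.coe_nonneg
  have hh0 := abs_nonneg h
  have hhη : |h| ≤ η.rOut := by nlinarith
  rw [zero_smul, add_zero, sub_zero, Real.norm_eq_abs, Real.norm_eq_abs]
  have e := mollify_sub_eq (μ := μ) (η := η) hφ p (h • W p) 1
  simp only [one_mul] at e
  rw [e]
  refine abs_mollify_le fun q hq => ?_
  -- Invariance replaces φ(p − q) by its value at the transported point. The two arguments then
  -- differ by h(W p − W(p − q)) plus an Euler error, and the Lipschitz bound on W makes the former
  -- at most |h| K ‖q‖.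
  rw [← hinv h (p - q)]
  have hWh : ‖h • W p‖ ≤ L * |h| := by
    rw [norm_smul, Real.norm_eq_abs, mul_comm]
    exact mul_le_mul_of_nonneg_right (hL p) hh0
  refine (hlip _ _ ?_ ?_).trans ?_
  · rw [dist_eq_norm, show p - q + h • W p - p = h • W p - q by abel]
    refine (norm_sub_le _ _).trans ?_
    nlinarith
  · refine (dist_triangle _ (p - q) _).trans ?_
    have := hΦ.dist_time_le hL (p - q) h 0
    rw [hΦ.map_zero, sub_zero] at this
    have h2 : dist (p - q) p = ‖q‖ := by simp
    nlinarith
  · have h1 := hΦ.dist_sub_le hW hL (p - q) h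
    have h2 : ‖W p - W (p - q)‖ ≤ K * ‖q‖ := by
      simpa [dist_eq_norm] using hW.dist_le_mul p (p - q)
    have h3 : dist (p - q + h • W p) (Φ h (p - q)) ≤ K * L * h ^ 2 + |h| * (K * ‖q‖) := by
      rw [dist_eq_norm, show p - q + h • W p - Φ h (p - q)
        = h • (W p - W (p - q)) - (Φ h (p - q) - (p - q + h • W (p - q))) by
          rw [smul_sub]; abel]
      refine (norm_sub_le _ _).trans ?_
      rw [norm_smul, Real.norm_eq_abs]
      nlinarith [mul_le_mul_of_nonneg_left h2 hh0]
    have h4 : K * L * h ^ 2 + |h| * (K * ‖q‖) ≤ K * (1 + L) * η.rOut * |h| := by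
      rw [← sq_abs h]
      have a1 : |h| * |h| ≤ η.rOut * |h| := mul_le_mul_of_nonneg_right hhη hh0
      have a2 : |h| * ‖q‖ ≤ |h| * η.rOut := mul_le_mul_of_nonneg_left hq.le hh0
      have a3 := mul_le_mul_of_nonneg_left a1 (mul_nonneg K.coe_nonneg hL0)
      have a4 := mul_le_mul_of_nonneg_left a2 K.coe_nonneg
      nlinarith
    calc _ ≤ Λ * (K * (1 + L) * η.rOut * |h|) := mul_le_mul_of_nonneg_left (h3.trans h4) hΛ
      _ = _ := by ring

end Mollify

/-! ### Weak solutions tested against Lipschitz functions constant along characteristics -/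

theorem abs_integral_mul_le_of_bound {α : Type*} [MeasurableSpace α] {μ : Measure α}
    {f g : α → ℝ} {B : Set α} (hB : MeasurableSet B) (hf : IntegrableOn f B μ) {c : ℝ}
    (hg : ∀ x ∈ B, |g x| ≤ c) (hg0 : ∀ x ∉ B, g x = 0) :
    |∫ x, f x * g x ∂μ| ≤ c * ∫ x in B, |f x| ∂μ := by
  rw [← integral_const_mul, ← integral_indicator hB]
  have hi : Integrable (B.indicator fun x => c * |f x|) μ :=
    (integrable_indicator_iff hB).2 (hf.abs.const_mul c)
  refine norm_integral_le_of_norm_le (f := fun x => f x * g x) hi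
    (Filter.Eventually.of_forall fun x => ?_)
  by_cases hx : x ∈ B
  · rw [indicator_of_mem hx, Real.norm_eq_abs, abs_mul, mul_comm]
    exact mul_le_mul_of_nonneg_right (hg x hx) (abs_nonneg _)
  · simp [hx, hg0 x hx]

theorem abs_integral_mul_sub_le {f g h : E3 → ℝ} {B : Set E3} (hB : IsCompact B)
    (hf : LocallyIntegrable f volume) (hg : Continuous g) (hh : Continuous h)
    (hg0 : ∀ x ∉ B, g x = 0) (hh0 : ∀ x ∉ B, h x = 0) {c : ℝ} (hc : ∀ x, |g x - h x| ≤ c) :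
    |(∫ x, f x * g x) - ∫ x, f x * h x| ≤ c * ∫ x in B, |f x| := by
  have hi1 : Integrable fun x => f x * g x :=
    hf.integrable_smul_right_of_hasCompactSupport hg (HasCompactSupport.intro hB hg0)
  have hi2 : Integrable fun x => f x * h x :=
    hf.integrable_smul_right_of_hasCompactSupport hh (HasCompactSupport.intro hB hh0)
  rw [← integral_sub hi1 hi2]
  simp only [← mul_sub]
  refine abs_integral_mul_le_of_bound hB.measurableSet (hf.integrableOn_isCompact hB)
    (fun x _ => hc x) fun x hx => ?_
  rw [hg0 x hx, hh0 x hx, sub_zero]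

theorem eq_of_forall_abs_sub_le_mul {a b C δ : ℝ} (hδ : 0 < δ)
    (h : ∀ e, 0 < e → e < δ → |a - b| ≤ C * e) : a = b := by
  have h1 : Filter.Tendsto (fun e : ℝ => C * e) (𝓝[>] 0) (𝓝 0) := by
    have : Continuous fun e : ℝ => C * e := by fun_prop
    simpa using (this.tendsto 0).mono_left (nhdsWithin_le_nhds (s := Ioi 0))
  have h2 : |a - b| ≤ 0 := by
    refine ge_of_tendsto h1 ?_
    filter_upwards [Ioo_mem_nhdsGT hδ] with e he using h e he.1 he.2
  exact sub_eq_zero.1 (abs_eq_zero.1 (le_antisymm h2 (abs_nonneg _)))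

/-- A weak solution can be tested against a merely Lipschitz function which is constant along the
characteristics of the velocity field. -/
theorem IsTransportSolution.integral_mul_eq {T : ℝ} {u : ℝ → E3 → E3} {ρ₀ : E3 → ℝ}
    {ρ : ℝ → E3 → ℝ} (hρ : IsTransportSolution T u ρ₀ ρ) (hρ₀ : LocallyIntegrable ρ₀ volume)
    {W : ℝ × E3 → ℝ × E3} {Φ : ℝ → ℝ × E3 → ℝ × E3} {K L : NNReal} (hΦ : IsGlobalFlow W Φ)
    (hW : LipschitzWith K W) (hL : ∀ p, ‖W p‖ ≤ L) {φ : ℝ × E3 → ℝ} (hφ : Continuous φ)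
    (hinv : ∀ s p, φ (Φ s p) = φ p)
    (hlip : ∀ N : ℝ, ∃ Λ : ℝ, 0 ≤ Λ ∧
      ∀ p q : ℝ × E3, |p.1| ≤ N → |q.1| ≤ N → |φ p - φ q| ≤ Λ * dist p q)
    {R R' δ : ℝ} (hδ : 0 < δ) (hR' : ∀ p : ℝ × E3, |p.1| ≤ T + 2 → R' < ‖p.2‖ → φ p = 0)
    (hR : ∀ p : ℝ × E3, p.1 ∈ Icc (-δ) (T + δ) → R < ‖p.2‖ → φ p = 0)
    (hWu : ∀ τ ∈ Icc 0 T, ∀ x, ‖x‖ ≤ R + δ → W (τ, x) = (1, u τ x)) {t : ℝ} (ht : t ∈ Icc 0 T) :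
    ∫ x, ρ t x * φ (t, x) = ∫ x, ρ₀ x * φ (0, x) := by
  have hT : 0 ≤ T := ht.1.trans ht.2
  have habs : ∀ τ ∈ Icc 0 T, |τ| ≤ T := fun τ hτ => by rw [abs_of_nonneg hτ.1]; exact hτ.2
  have habs1 : T ≤ T + 1 := by linarith
  have habs2 : T ≤ T + 2 := by linarith
  have hlt : ∀ s, R' + 1 < s → R' < s := fun s hs => by linarith
  obtain ⟨Λ, hΛ0, hΛ⟩ := hlip (T + 1 + L)
  -- Two support radii occur. R' is crude and only serves compactness, with a margin 1 for the
  -- mollifier; R is the one tied to the region where W is the true field.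
  set B : Set E3 := Metric.closedBall 0 (R' + 1) with hB
  have hBc : IsCompact B := isCompact_closedBall _ _
  have hBm : MeasurableSet B := measurableSet_closedBall
  have hBn : ∀ x ∉ B, R' + 1 < ‖x‖ := fun x hx => by
    rwa [hB, mem_closedBall_zero_iff, not_le] at hx
  clear_value B
  have hρprod : IntegrableOn (fun p : ℝ × E3 => ρ p.1 p.2) (Icc 0 T ×ˢ B) volume :=
    (hρ.locallyIntegrableOn.mono_set (prod_mono le_rfl (subset_univ _))).integrableOn_isCompact
      (isCompact_Icc.prod hBc)
  have hρB : ∀ τ ∈ Icc 0 T, IntegrableOn (ρ τ) B volume := fun τ hτ =>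
    (hρ.locallyIntegrable τ hτ).integrableOn_isCompact hBc
  set I : ℝ → ℝ := fun τ => ∫ x in B, |ρ τ x|
  have hI : IntegrableOn I (Icc 0 T) volume := by
    have h1 : Integrable (fun p : ℝ × E3 => ρ p.1 p.2)
        ((volume.restrict (Icc 0 T)).prod (volume.restrict B)) := by
      rw [Measure.prod_restrict]
      exact hρprod
    exact h1.integral_norm_prod_left
  set C := Λ * K * (1 + L) with hC
  have hC0 : 0 ≤ C := by positivity
  refine eq_of_forall_abs_sub_le_mul (δ := min δ 1)
    (C := Λ * I t + Λ * (∫ x in B, |ρ₀ x|) + C * ∫ τ in (0 : ℝ)..t, I τ) (lt_min hδ one_pos)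
    fun e he0 heδ => ?_
  have heδ' : e < δ := heδ.trans_le (min_le_left _ _)
  have he1 : e < 1 := heδ.trans_le (min_le_right _ _)
  let η : ContDiffBump (0 : ℝ × E3) := ⟨e / 2, e, by linarith, by linarith⟩
  -- The mollified function has bounded support in space only for bounded times. This time cutoff
  -- equals 1 on a neighbourhood of [0, T], so it makes the support compact without changing values
  -- or derivatives there.
  let κ : ContDiffBump (0 : ℝ) := ⟨T + 1 / 2, T + 1, by linarith, by linarith⟩
  set φe := mollify ((volume : Measure ℝ).prod (volume : Measure E3)) η φ with hφe
  have hφes : ContDiff ℝ ∞ φe := contDiff_mollify hφ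
  have hfar : ∀ p : ℝ × E3, |p.1| ≤ T + 1 → R' + 1 < ‖p.2‖ → φe p = 0 := by
    intro p hp1 hp2
    refine abs_nonpos_iff.1 (abs_mollify_le fun q hq => ?_)
    have hq1 : |q.1| < e := (norm_fst_le q).trans_lt hq
    have hq2 : ‖q.2‖ < e := (norm_snd_le q).trans_lt hq
    rw [hR' (p - q), abs_zero]
    · exact (abs_sub _ _).trans (by linarith)
    · have := norm_sub_norm_le p.2 q.2
      exact lt_of_lt_of_le (by linarith) this
  have hnear : ∀ p : ℝ × E3, |p.1| ≤ T → |φe p - φ p| ≤ Λ * e := by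
    intro p hp1
    refine abs_mollify_sub_le hφ fun q hq => ?_
    have hq1 : |q.1| < e := (norm_fst_le q).trans_lt hq
    have hL0 : (0 : ℝ) ≤ L := L.coe_nonneg
    refine (hΛ _ _ ((abs_sub _ _).trans (by linarith)) (by linarith)).trans ?_
    refine mul_le_mul_of_nonneg_left ?_ hΛ0
    simpa [dist_eq_norm] using hq.le
  have hder : ∀ τ ∈ Icc 0 T, ∀ x, |fderiv ℝ φe (τ, x) (1, u τ x)| ≤ C * e := by
    intro τ hτ x
    -- Inside this ball W = (1, u) and the mollification estimate applies. Outside it φ vanishes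
    -- throughout an e-neighbourhood, because e < δ, and so does the mollified function near (τ, x).
    by_cases hx : ‖x‖ ≤ R + δ
    · rw [← hWu τ hτ x hx]
      refine abs_fderiv_mollify_le hΦ hW hL hφ hinv hΛ0 (fun q q' hq hq' => hΛ q q' ?_ ?_) he1.le
      · have h1 : |q.1 - τ| ≤ 1 + L := (norm_fst_le (q - (τ, x))).trans (by rwa [← dist_eq_norm])
        rw [abs_le] at h1 ⊢
        constructor <;> linarith [h1.1, h1.2, hτ.1, hτ.2]
      · have h1 : |q'.1 - τ| ≤ 1 + L := (norm_fst_le (q' - (τ, x))).trans (by rwa [← dist_eq_norm])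
        rw [abs_le] at h1 ⊢
        constructor <;> linarith [h1.1, h1.2, hτ.1, hτ.2]
    · have hz : φe =ᶠ[𝓝 (τ, x)] fun _ => 0 := by
        have hn : Ioo (-(δ - e)) (T + (δ - e)) ×ˢ {x : E3 | R + e < ‖x‖} ∈ 𝓝 (τ, x) := by
          refine prod_mem_nhds (Ioo_mem_nhds (by linarith [hτ.1]) (by linarith [hτ.2])) ?_
          exact (isOpen_lt continuous_const continuous_norm).mem_nhds
            (show R + e < ‖x‖ by linarith [not_le.1 hx])
        filter_upwards [hn] with p hp
        refine abs_nonpos_iff.1 (abs_mollify_le fun q hq => ?_)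
        have hq1 : |q.1| < e := (norm_fst_le q).trans_lt hq
        have hq2 : ‖q.2‖ < e := (norm_snd_le q).trans_lt hq
        have hp1 := hp.1
        have hp2 : R + e < ‖p.2‖ := hp.2
        rw [abs_lt] at hq1
        rw [hR (p - q), abs_zero]
        · exact ⟨by simp only [Prod.fst_sub]; linarith [hp1.1, hq1.2],
            by simp only [Prod.fst_sub]; linarith [hp1.2, hq1.1]⟩
        · have := norm_sub_norm_le p.2 q.2
          exact lt_of_lt_of_le (by linarith) this
      rw [hz.fderiv_eq]
      simp only [fderiv_fun_const, Pi.zero_apply, _root_.zero_apply, abs_zero]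
      positivity
  have hder0 : ∀ τ ∈ Icc 0 T, ∀ x ∉ B, fderiv ℝ φe (τ, x) = 0 := by
    intro τ hτ x hx
    replace hx := hBn x hx
    have hz : φe =ᶠ[𝓝 (τ, x)] fun _ => 0 := by
      have hn : Ioo (-1) (T + 1) ×ˢ {x : E3 | R' + 1 < ‖x‖} ∈ 𝓝 (τ, x) := by
        refine prod_mem_nhds (Ioo_mem_nhds (by linarith [hτ.1]) (by linarith [hτ.2])) ?_
        exact (isOpen_lt continuous_const continuous_norm).mem_nhds hx
      filter_upwards [hn] with p hp
      exact hfar p (abs_le.2 ⟨by linarith [hp.1.1], hp.1.2.le⟩) hp.2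
    rw [hz.fderiv_eq]
    simp
  set ψ : ℝ × E3 → ℝ := fun p => κ p.1 * φe p with hψ
  have hψφ : ∀ τ ∈ Icc 0 T, ∀ x, ψ (τ, x) = φe (τ, x) := by
    intro τ hτ x
    have : κ τ = 1 := by
      refine κ.one_of_mem_closedBall ?_
      rw [mem_closedBall_zero_iff, Real.norm_eq_abs, abs_le]
      change -(T + 1 / 2) ≤ τ ∧ τ ≤ T + 1 / 2
      constructor <;> linarith [hτ.1, hτ.2]
    simp [hψ, this]
  have hψd : ∀ τ ∈ Icc 0 T, ∀ x, fderiv ℝ ψ (τ, x) = fderiv ℝ φe (τ, x) := by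
    intro τ hτ x
    refine Filter.EventuallyEq.fderiv_eq ?_
    have hn : Metric.ball (0 : ℝ) (T + 1 / 2) ×ˢ (univ : Set E3) ∈ 𝓝 (τ, x) := by
      refine prod_mem_nhds (Metric.isOpen_ball.mem_nhds ?_) Filter.univ_mem
      rw [mem_ball_zero_iff, Real.norm_eq_abs, abs_lt]
      constructor <;> linarith [hτ.1, hτ.2]
    filter_upwards [hn] with p hp
    have : κ p.1 = 1 := κ.one_of_mem_closedBall (Metric.ball_subset_closedBall hp.1)
    simp [hψ, this]
  have hψs : ContDiff ℝ ∞ ψ := (κ.contDiff.comp contDiff_fst).mul hφes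
  have hψc : HasCompactSupport ψ := by
    refine HasCompactSupport.intro ((isCompact_closedBall (0 : ℝ) (T + 1)).prod hBc) fun p hp => ?_
    by_cases h1 : p.1 ∈ Metric.closedBall (0 : ℝ) (T + 1)
    · have h2 : p.2 ∉ B := fun h2 => hp ⟨h1, h2⟩
      rw [hB, mem_closedBall_zero_iff, not_le] at h2
      rw [mem_closedBall_zero_iff] at h1
      simp [hψ, hfar p h1 h2]
    · have : κ p.1 = 0 := κ.zero_of_le_dist (not_le.1 h1).le
      simp [hψ, this]
  clear_value ψ φe
  have hweak := hρ.weak_eq ψ hψs hψc t ht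
  have hslice : ∀ (f : E3 → ℝ), LocallyIntegrable f volume →
      ∀ τ ∈ Icc 0 T, |(∫ x, f x * ψ (τ, x)) - ∫ x, f x * φ (τ, x)| ≤ Λ * e * ∫ x in B, |f x| := by
    intro f hf τ hτ
    have hτ' := habs τ hτ
    have hslc : ∀ f : ℝ × E3 → ℝ, Continuous f → Continuous fun x => f (τ, x) :=
      fun f hf => hf.comp (Continuous.prodMk_right τ)
    have hψc' := hψs.continuous
    have hc1 : Continuous fun x => ψ (τ, x) := hslc ψ hψc'
    have hc2 : Continuous fun x => φ (τ, x) := hslc φ hφ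
    have hs1 : ∀ x ∉ B, ψ (τ, x) = 0 := fun x hx =>
      (hψφ τ hτ x).trans (hfar _ (hτ'.trans habs1) (hBn x hx))
    have hs2 : ∀ x ∉ B, φ (τ, x) = 0 := fun x hx =>
      hR' _ (hτ'.trans habs2) (hlt _ (hBn x hx))
    refine abs_integral_mul_sub_le hBc hf hc1 hc2 hs1 hs2 fun x => ?_
    rw [hψφ τ hτ]
    exact hnear _ hτ'
  have hrhs : |∫ τ in (0 : ℝ)..t, ∫ x, ρ τ x * fderiv ℝ ψ (τ, x) (1, u τ x)|
      ≤ C * e * ∫ τ in (0 : ℝ)..t, I τ := by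
    rw [← intervalIntegral.integral_const_mul]
    have hIi : IntervalIntegrable I volume 0 t := by
      rw [intervalIntegrable_iff_integrableOn_Icc_of_le ht.1]
      exact hI.mono_set (Icc_subset_Icc_right ht.2)
    refine intervalIntegral.norm_integral_le_of_norm_le
      (f := fun τ => ∫ x, ρ τ x * fderiv ℝ ψ (τ, x) (1, u τ x)) ht.1
      (Filter.Eventually.of_forall fun τ hτ => ?_) (hIi.const_mul _)
    have hτ' : τ ∈ Icc 0 T := ⟨hτ.1.le, hτ.2.trans ht.2⟩
    refine abs_integral_mul_le_of_bound hBm (hρB τ hτ') (fun x _ => ?_) fun x hx => ?_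
    · rw [hψd τ hτ']
      exact hder τ hτ' x
    · rw [hψd τ hτ', hder0 τ hτ' x hx]
      simp
  have h1 := hslice (ρ t) (hρ.locallyIntegrable t ht) t ht
  have h2 := hslice ρ₀ hρ₀ 0 ⟨le_rfl, hT⟩
  rw [← hweak] at hrhs
  have hfin : ∀ a b c d x y z : ℝ, |a - c| ≤ x → |b - d| ≤ y → |a - b| ≤ z →
      |c - d| ≤ x + y + z := by
    intro a b c d x y z h1 h2 h3
    rw [abs_le] at *
    constructor <;> linarith [h1.1, h1.2, h2.1, h2.2, h3.1, h3.2]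
  refine (hfin _ _ _ _ _ _ _ h1 h2 hrhs).trans_eq ?_
  ring

/-! ### Constants as weak solutions -/

theorem contDiff_slice {T : ℝ} {u : ℝ → E3 → E3}
    (hu : ContDiffOn ℝ ∞ (fun p : ℝ × E3 => u p.1 p.2) (Icc 0 T ×ˢ univ)) {τ : ℝ}
    (hτ : τ ∈ Icc 0 T) : ContDiff ℝ ∞ (u τ) := by
  have h : ContDiff ℝ ∞ fun x : E3 => (τ, x) := contDiff_prodMk_right τ
  exact contDiffOn_univ.1 (hu.comp h.contDiffOn fun x _ => ⟨hτ, trivial⟩)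

/-- Integration by parts in each coordinate leaves −∫ χ div v. -/
theorem integral_fderiv_apply_eq_zero {v : E3 → E3} (hv : ContDiff ℝ 1 v) (hdiv : ∀ x, div v x = 0)
    {χ : E3 → ℝ} (hχ : ContDiff ℝ 1 χ) (hχc : HasCompactSupport χ) :
    ∫ x, fderiv ℝ χ x (v x) = 0 := by
  have hχ0 := hχ.continuous
  have hχ' : Continuous (fderiv ℝ χ) := hχ.continuous_fderiv one_ne_zero
  have hχ'c : HasCompactSupport (fderiv ℝ χ) := hχc.fderiv ℝ
  have hvi : ∀ i : Fin 3, ContDiff ℝ 1 fun x => v x i := fun i => contDiff_coord hv i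
  have hpd : ∀ i : Fin 3, Continuous fun x => pd i v x i := fun i =>
    (contDiff_coord (contDiff_pd (n := 0) hv i) i).continuous
  have hcs : ∀ i : Fin 3, HasCompactSupport fun x => fderiv ℝ χ x (EuclideanSpace.single i 1) :=
    fun i => hχ'c.comp_left (g := fun L : E3 →L[ℝ] ℝ => L (EuclideanSpace.single i 1)) rfl
  have hi1 : ∀ i : Fin 3, Integrable fun x => v x i * fderiv ℝ χ x (EuclideanSpace.single i 1) :=
    fun i => ((hvi i).continuous.mul (hχ'.clm_apply continuous_const)).integrable_of_hasCompactSupport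
      (hcs i).mul_left
  have hi2 : ∀ i : Fin 3, Integrable fun x => pd i v x i * χ x := fun i =>
    ((hpd i).mul hχ0).integrable_of_hasCompactSupport hχc.mul_left
  have key : ∀ i : Fin 3, ∫ x, v x i * fderiv ℝ χ x (EuclideanSpace.single i 1)
      = -∫ x, pd i v x i * χ x := by
    intro i
    have h := integral_mul_fderiv_eq_neg_fderiv_mul_of_integrable (μ := (volume : Measure E3))
      (f := fun x => v x i) (g := χ) (v := EuclideanSpace.single i (1 : ℝ))
      (by simpa only [pd_apply (hv.differentiable one_ne_zero _)] using hi2 i) (hi1 i)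
      (((hvi i).continuous.mul hχ0).integrable_of_hasCompactSupport hχc.mul_left)
      (fun x _ => (hvi i).differentiable one_ne_zero x)
      (fun x _ => hχ.differentiable one_ne_zero x)
    simpa only [pd_apply (hv.differentiable one_ne_zero _)] using h
  simp only [sum_coord_mul_eq (fderiv ℝ χ _) (v _)]
  rw [integral_finsetSum _ fun i _ => hi1 i]
  simp only [key]
  rw [Finset.sum_neg_distrib, ← integral_finsetSum _ fun i _ => hi2 i]
  simp only [← Finset.sum_mul]
  have : ∀ x, ∑ i, pd i v x i = 0 := hdiv
  simp [this]

theorem hasDerivAt_integral_slice {φ : ℝ × E3 → ℝ} (hφ : ContDiff ℝ 1 φ)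
    (hφc : HasCompactSupport φ) (τ : ℝ) :
    HasDerivAt (fun τ => ∫ x, φ (τ, x)) (∫ x, fderiv ℝ φ (τ, x) (1, 0)) τ := by
  have hc := hφ.continuous
  have hc' : Continuous (fderiv ℝ φ) := hφ.continuous_fderiv one_ne_zero
  have hK : IsCompact (Prod.snd '' tsupport φ) := hφc.isCompact.image continuous_snd
  have hout : ∀ l : ℝ, ∀ y ∉ Prod.snd '' tsupport φ, (l, y) ∉ tsupport φ :=
    fun l y hy h => hy ⟨_, h, rfl⟩
  refine hasDerivAt_integral_of_continuous_of_compact (F := fun τ x => φ (τ, x))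
    (F' := fun τ x => fderiv ℝ φ (τ, x) (1, 0)) hK hK.measurableSet ?_ ?_ ?_ ?_ ?_ τ
  · simpa only [Function.uncurry_def] using hc
  · simp only [Function.uncurry_def]; fun_prop
  · exact fun l y hy => image_eq_zero_of_notMem_tsupport (hout l y hy)
  · intro l y hy
    have : fderiv ℝ φ (l, y) = 0 :=
      image_eq_zero_of_notMem_tsupport fun h => hout l y hy (tsupport_fderiv_subset ℝ h)
    simp [this]
  · intro l y
    have h1 : HasDerivAt (fun l : ℝ => (l, y)) ((1 : ℝ), (0 : E3)) l :=
      (hasDerivAt_id l).prodMk (hasDerivAt_const l y)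
    exact (hφ.differentiable one_ne_zero (l, y)).hasFDerivAt.comp_hasDerivAt l h1

/-- Constants are transported by a divergence-free velocity field. -/
theorem isTransportSolution_one {T : ℝ} {u : ℝ → E3 → E3}
    (hu : ContDiffOn ℝ ∞ (fun p : ℝ × E3 => u p.1 p.2) (Icc 0 T ×ˢ univ))
    (hdiv : ∀ t ∈ Icc 0 T, ∀ x, div (u t) x = 0) :
    IsTransportSolution T u (fun _ => 1) (fun _ _ => 1) where
  locallyIntegrableOn := (locallyIntegrable_const (μ := (volume : Measure ℝ).prod
    (volume : Measure E3)) (1 : ℝ)).locallyIntegrableOn _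
  locallyIntegrable t _ := locallyIntegrable_const 1
  weak_eq φ hφ hφc t ht := by
    simp only [one_mul]
    have hφ1 : ContDiff ℝ 1 φ := hφ.of_le (by exact_mod_cast le_top)
    have hc' : Continuous (fderiv ℝ φ) := hφ1.continuous_fderiv one_ne_zero
    have h2 : ContDiff ℝ 1 fun p => fderiv ℝ φ p (1, 0) :=
      (hφ.fderiv_right (m := 1) (by rw [one_add_one_eq_two]; exact WithTop.coe_le_coe.2 (le_top : (2 : ℕ∞) ≤ ⊤))).clm_apply contDiff_const
    have h2c : HasCompactSupport fun p => fderiv ℝ φ p (1, 0) :=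
      (hφc.fderiv ℝ).comp_left (g := fun L : ℝ × E3 →L[ℝ] ℝ => L (1, 0)) rfl
    have hcont : Continuous fun τ => ∫ x, fderiv ℝ φ (τ, x) (1, 0) :=
      continuous_iff_continuousAt.2 fun τ => (hasDerivAt_integral_slice h2 h2c τ).continuousAt
    rw [← intervalIntegral.integral_eq_sub_of_hasDerivAt
      (fun τ _ => hasDerivAt_integral_slice hφ1 hφc τ) (hcont.intervalIntegrable _ _)]
    refine intervalIntegral.integral_congr fun τ hτ => ?_
    rw [uIcc_of_le ht.1] at hτ
    have hτ' : τ ∈ Icc 0 T := ⟨hτ.1, hτ.2.trans ht.2⟩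
    have hv : ContDiff ℝ 1 (u τ) := (contDiff_slice hu hτ').of_le (by simp)
    have hvc := hv.continuous
    have hslice : ContDiff ℝ 1 fun x => φ (τ, x) := hφ1.comp (contDiff_prodMk_right τ)
    have hK : IsCompact (Prod.snd '' tsupport φ) := hφc.isCompact.image continuous_snd
    have hsupp : ∀ x ∉ Prod.snd '' tsupport φ, (τ, x) ∉ tsupport φ :=
      fun x hx h => hx ⟨_, h, rfl⟩
    have hslicec : HasCompactSupport fun x => φ (τ, x) := HasCompactSupport.intro hK
      fun x hx => image_eq_zero_of_notMem_tsupport (hsupp x hx)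
    have hd : ∀ x w, fderiv ℝ (fun x => φ (τ, x)) x w = fderiv ℝ φ (τ, x) (0, w) := by
      intro x w
      have h1 : HasFDerivAt (fun x : E3 => (τ, x)) (ContinuousLinearMap.inr ℝ ℝ E3) x :=
        hasFDerivAt_prodMk_right τ x
      have := (hφ1.differentiable one_ne_zero (τ, x)).hasFDerivAt.comp x h1
      rw [show (fun x => φ (τ, x)) = φ ∘ fun x => (τ, x) from rfl, this.fderiv]
      rfl
    have h0 := integral_fderiv_apply_eq_zero hv (hdiv τ hτ') hslice hslicec
    simp only [hd] at h0
    have hz : ∀ x ∉ Prod.snd '' tsupport φ, fderiv ℝ φ (τ, x) = 0 := fun x hx =>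
      image_eq_zero_of_notMem_tsupport fun h => hsupp x hx (tsupport_fderiv_subset ℝ h)
    have hi : ∀ w : E3 → ℝ × E3, Continuous w → Integrable fun x => fderiv ℝ φ (τ, x) (w x) :=
      fun w hw => Continuous.integrable_of_hasCompactSupport (by fun_prop)
        (HasCompactSupport.intro hK fun x hx => by simp [hz x hx])
    have hadd : ∀ x, fderiv ℝ φ (τ, x) (1, u τ x)
        = fderiv ℝ φ (τ, x) (1, 0) + fderiv ℝ φ (τ, x) (0, u τ x) := fun x => by
      rw [← map_add]; simp
    simp only [hadd]
    rw [integral_add (hi (fun _ => (1, 0)) (by fun_prop)) (hi (fun x => (0, u τ x)) (by fun_prop)),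
      h0, add_zero]

/-! ### Cutting the velocity off to a bounded Lipschitz field -/

/-- The projection of the time axis onto `[0, T]`. -/
noncomputable def clampTime (T τ : ℝ) : ℝ := max 0 (min T τ)

theorem clampTime_mem {T : ℝ} (hT : 0 ≤ T) (τ : ℝ) : clampTime T τ ∈ Icc 0 T :=
  ⟨le_max_left _ _, max_le hT (min_le_left _ _)⟩

theorem clampTime_of_mem {T τ : ℝ} (hτ : τ ∈ Icc 0 T) : clampTime T τ = τ := by
  rw [clampTime, min_eq_right hτ.2, max_eq_right hτ.1]

theorem lipschitzWith_clampTime (T : ℝ) : LipschitzWith 1 (clampTime T) :=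
  (LipschitzWith.id.const_min T).const_max 0

/-- Two points either lie both in the larger ball, or are zeros of f both, or are at distance at
least 1; in the last case the bound L on f acts as a Lipschitz constant. -/
theorem lipschitzWith_of_lipschitzOnWith_of_eq_zero {f : ℝ × E3 → E3} {K L : NNReal} {R : ℝ}
    (hf : LipschitzOnWith K f {p | ‖p.2‖ ≤ R + 1}) (hL : ∀ p, ‖f p‖ ≤ L)
    (h0 : ∀ p, R ≤ ‖p.2‖ → f p = 0) : LipschitzWith (max K L) f := by
  have hfar : ∀ p q : ℝ × E3, ‖p.2‖ < R → R + 1 < ‖q.2‖ → dist (f p) (f q) ≤ L * dist p q := by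
    intro p q hp hq
    rw [h0 q (by linarith), dist_zero_right]
    have h1 : 1 ≤ dist p q := by
      have h2 : dist p.2 q.2 ≤ dist p q := le_max_right _ _
      have h3 := norm_sub_norm_le q.2 p.2
      rw [← dist_eq_norm, dist_comm] at h3
      linarith
    calc ‖f p‖ ≤ L * 1 := by simpa using hL p
      _ ≤ _ := mul_le_mul_of_nonneg_left h1 L.coe_nonneg
  refine LipschitzWith.of_dist_le_mul fun p q => ?_
  have hK : (K : ℝ) * dist p q ≤ (max K L : NNReal) * dist p q :=
    mul_le_mul_of_nonneg_right (NNReal.coe_le_coe.2 (le_max_left _ _)) dist_nonneg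
  have hL' : (L : ℝ) * dist p q ≤ (max K L : NNReal) * dist p q :=
    mul_le_mul_of_nonneg_right (NNReal.coe_le_coe.2 (le_max_right _ _)) dist_nonneg
  by_cases hp : ‖p.2‖ ≤ R + 1 <;> by_cases hq : ‖q.2‖ ≤ R + 1
  · exact (hf.dist_le_mul p hp q hq).trans hK
  · by_cases hp' : ‖p.2‖ < R
    · exact (hfar p q hp' (not_le.1 hq)).trans hL'
    · rw [h0 p (not_lt.1 hp'), h0 q (by linarith), dist_self]; positivity
  · by_cases hq' : ‖q.2‖ < R
    · rw [dist_comm, dist_comm p q] at *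
      exact (hfar q p hq' (not_le.1 hp)).trans hL'
    · rw [h0 q (not_lt.1 hq'), h0 p (by linarith), dist_self]; positivity
  · rw [h0 q (by linarith), h0 p (by linarith), dist_self]; positivity

/-- A smooth field on `[0, T] × ℝ³` agrees on a ball with a bounded Lipschitz field on
`ℝ × ℝ³`, obtained by multiplying it by a cutoff. -/
theorem exists_cutoff_field {T : ℝ} (hT : 0 ≤ T) {u : ℝ → E3 → E3}
    (hu : ContDiffOn ℝ ∞ (fun p : ℝ × E3 => u p.1 p.2) (Icc 0 T ×ˢ univ)) {R : ℝ} (hR : 0 < R) :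
    ∃ (θ : E3 → ℝ) (K L : NNReal), Continuous θ ∧ (∀ x, θ x ∈ Icc (0 : ℝ) 1) ∧
      (∀ x, ‖x‖ ≤ R → θ x = 1) ∧
      LipschitzWith K (fun p : ℝ × E3 => θ p.2 • u (clampTime T p.1) p.2) ∧
      ∀ p : ℝ × E3, ‖θ p.2 • u (clampTime T p.1) p.2‖ ≤ L := by
  obtain ⟨θ, hθs, hθm, hθ1, h0⟩ : ∃ θ : E3 → ℝ, ContDiff ℝ ∞ θ ∧ (∀ x, θ x ∈ Icc (0 : ℝ) 1) ∧
      (∀ x, ‖x‖ ≤ R → θ x = 1) ∧ ∀ x, R + 1 ≤ ‖x‖ → θ x = 0 := by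
    let θ : ContDiffBump (0 : E3) := ⟨R, R + 1, hR, by linarith⟩
    exact ⟨θ, θ.contDiff, fun x => ⟨θ.nonneg, θ.le_one⟩,
      fun x hx => θ.one_of_mem_closedBall (by simpa using hx),
      fun x hx => θ.zero_of_le_dist (by simpa using hx)⟩
  set B : Set (ℝ × E3) := Icc 0 T ×ˢ Metric.closedBall 0 (R + 1 + 1)
  have hB : IsCompact B := isCompact_Icc.prod (isCompact_closedBall _ _)
  have hf : ContDiffOn ℝ ∞ (fun p : ℝ × E3 => θ p.2 • u p.1 p.2) B := by
    have h1 : ContDiff ℝ ∞ fun p : ℝ × E3 => θ p.2 := hθs.comp contDiff_snd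
    exact h1.contDiffOn.smul (hu.mono (prod_mono le_rfl (subset_univ _)))
  obtain ⟨K, hK⟩ := hf.exists_lipschitzOnWith (by simp)
    ((convex_Icc 0 T).prod (convex_closedBall _ _)) hB
  obtain ⟨C, hC⟩ := hB.exists_bound_of_continuousOn hf.continuousOn
  have hbd : ∀ p : ℝ × E3, ‖θ p.2 • u (clampTime T p.1) p.2‖ ≤ C.toNNReal := by
    intro p
    by_cases hp : ‖p.2‖ ≤ R + 1 + 1
    · exact (hC (clampTime T p.1, p.2) ⟨clampTime_mem hT _, by simpa using hp⟩).trans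
        (Real.le_coe_toNNReal C)
    · rw [h0 p.2 (by linarith)]
      simp
  refine ⟨θ, max K C.toNNReal, C.toNNReal, hθs.continuous, hθm, hθ1,
    lipschitzWith_of_lipschitzOnWith_of_eq_zero (R := R + 1) ?_ hbd ?_, hbd⟩
  · refine LipschitzOnWith.of_dist_le_mul fun p hp q hq => ?_
    have h1 := hK.dist_le_mul (clampTime T p.1, p.2) ⟨clampTime_mem hT _, by simpa using hp⟩
      (clampTime T q.1, q.2) ⟨clampTime_mem hT _, by simpa using hq⟩
    refine h1.trans (mul_le_mul_of_nonneg_left ?_ K.coe_nonneg)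
    have h2 := (lipschitzWith_clampTime T).dist_le_mul p.1 q.1
    rw [NNReal.coe_one, one_mul] at h2
    exact max_le_max h2 le_rfl
  · intro p hp
    rw [h0 p.2 hp, zero_smul]

/-! ### Bounds along trajectories -/

/-- The majorant enters through a lower integral, so it may fail to be measurable; measurability in
time of the spatial norms of u is thereby avoided. -/
theorem abs_sub_le_toReal_lintegral {f f' : ℝ → ℝ} {g : ℝ → ℝ≥0∞} {t : ℝ}
    (hf : ∀ s ∈ Icc 0 t, HasDerivAt f (f' s) s) (hf' : ContinuousOn f' (Icc 0 t))
    (hg : ∀ᵐ s ∂volume.restrict (Icc 0 t), ‖f' s‖ₑ ≤ g s) (hfin : ∫⁻ s in Icc 0 t, g s < ⊤)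
    {a b : ℝ} (ha : a ∈ Icc 0 t) (hb : b ∈ Icc 0 t) :
    |f b - f a| ≤ (∫⁻ s in Icc 0 t, g s).toReal := by
  have hsub : uIcc a b ⊆ Icc 0 t := uIcc_subset_Icc ha hb
  rw [← intervalIntegral.integral_eq_sub_of_hasDerivAt (fun s hs => hf s (hsub hs))
    ((hf'.mono hsub).intervalIntegrable), ← Real.norm_eq_abs,
    intervalIntegral.norm_intervalIntegral_eq, ← toReal_enorm]
  refine ENNReal.toReal_mono hfin.ne ?_
  refine (enorm_integral_le_lintegral_enorm _).trans ?_
  exact (lintegral_mono_set (uIoc_subset_uIcc.trans hsub)).trans (lintegral_mono_ae hg)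

/-- Grönwall in both directions of time, from the monotonicity of f e^{∓Ks}. With f = r² it shows
that a trajectory on the axis stays there and that one off the axis never reaches it. -/
theorem le_mul_exp_of_abs_deriv_le {f f' : ℝ → ℝ} {K t : ℝ}
    (hf : ∀ s ∈ Icc 0 t, HasDerivAt f (f' s) s) (hK : ∀ s ∈ Icc 0 t, |f' s| ≤ K * f s)
    {a b : ℝ} (ha : a ∈ Icc 0 t) (hb : b ∈ Icc 0 t) : f b ≤ f a * Real.exp (K * |b - a|) := by
  have hexp : ∀ c s : ℝ, HasDerivAt (fun s => Real.exp (c * s)) (Real.exp (c * s) * c) s :=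
    fun c s => by simpa using ((hasDerivAt_id s).const_mul c).exp
  have hmul : ∀ c : ℝ, ∀ s ∈ Icc 0 t, HasDerivAt (fun s => f s * Real.exp (c * s))
      (f' s * Real.exp (c * s) + f s * (Real.exp (c * s) * c)) s :=
    fun c s hs => (hf s hs).mul (hexp c s)
  have hcont : ∀ c : ℝ, ContinuousOn (fun s => f s * Real.exp (c * s)) (Icc 0 t) :=
    fun c s hs => (hmul c s hs).continuousAt.continuousWithinAt
  rcases le_total a b with hab | hab
  · have hanti : AntitoneOn (fun s => f s * Real.exp (-K * s)) (Icc 0 t) := by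
      refine antitoneOn_of_deriv_nonpos (convex_Icc 0 t) (hcont _)
        (fun s hs => (hmul _ s (interior_subset hs)).differentiableAt.differentiableWithinAt)
        fun s hs => ?_
      rw [(hmul _ s (interior_subset hs)).deriv]
      have h1 := (abs_le.1 (hK s (interior_subset hs))).2
      have h2 := Real.exp_pos (-K * s)
      nlinarith
    have h := hanti ha hb hab
    simp only at h
    rw [abs_of_nonneg (sub_nonneg.2 hab), show K * (b - a) = -K * a + K * b by ring, Real.exp_add,
      ← mul_assoc]
    calc f b = f b * Real.exp (-K * b) * Real.exp (K * b) := by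
          rw [mul_assoc, ← Real.exp_add]; simp
      _ ≤ _ := mul_le_mul_of_nonneg_right h (Real.exp_pos _).le
  · have hmono : MonotoneOn (fun s => f s * Real.exp (K * s)) (Icc 0 t) := by
      refine monotoneOn_of_deriv_nonneg (convex_Icc 0 t) (hcont _)
        (fun s hs => (hmul _ s (interior_subset hs)).differentiableAt.differentiableWithinAt)
        fun s hs => ?_
      rw [(hmul _ s (interior_subset hs)).deriv]
      have h1 := (abs_le.1 (hK s (interior_subset hs))).1
      have h2 := Real.exp_pos (K * s)
      nlinarith
    have h := hmono hb ha hab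
    simp only at h
    rw [abs_of_nonpos (sub_nonpos.2 hab), show K * -(b - a) = K * a + -(K * b) by ring,
      Real.exp_add, ← mul_assoc]
    calc f b = f b * Real.exp (K * b) * Real.exp (-(K * b)) := by
          rw [mul_assoc, ← Real.exp_add]; simp
      _ ≤ _ := mul_le_mul_of_nonneg_right h (Real.exp_pos _).le

/-- The essential bound holds on a dense set and passes to points of continuity. It is needed at
every point because a trajectory is a null set. -/
theorem enorm_le_eLpNorm_top_of_continuousAt {f : E3 → ℝ} {x : E3} (hf : ContinuousAt f x) :
    ‖f x‖ₑ ≤ eLpNorm f ⊤ volume := by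
  have hd : Dense {y | ‖f y‖ₑ ≤ eLpNorm f ⊤ volume} := by
    rw [eLpNorm_exponent_top]
    exact Measure.dense_of_ae (ae_le_eLpNormEssSup (f := f))
  have hfr := mem_closure_iff_frequently.1 (hd x)
  exact le_of_tendsto_of_frequently (hf.enorm) hfr

theorem r_nonneg (x : E3) : 0 ≤ r x := Real.sqrt_nonneg _

theorem r_sq (x : E3) : r x ^ 2 = x 0 ^ 2 + x 1 ^ 2 := Real.sq_sqrt (by positivity)

theorem continuous_r : Continuous r := by unfold r; fun_prop

theorem r_le_norm (x : E3) : r x ≤ ‖x‖ := by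
  refine (sq_le_sq₀ (r_nonneg x) (norm_nonneg x)).1 ?_
  rw [r_sq, EuclideanSpace.real_norm_sq_eq, Fin.sum_univ_three]
  nlinarith [sq_nonneg (x 2)]

theorem norm_le_r_add (x : E3) : ‖x‖ ≤ r x + |x 2| := by
  refine (sq_le_sq₀ (norm_nonneg x) (add_nonneg (r_nonneg x) (abs_nonneg _))).1 ?_
  rw [EuclideanSpace.real_norm_sq_eq, Fin.sum_univ_three, add_sq, r_sq, sq_abs]
  have := mul_nonneg (r_nonneg x) (abs_nonneg (x 2))
  linarith

theorem abs_vertical_le_norm (x : E3) : |x 2| ≤ ‖x‖ := by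
  simpa using PiLp.norm_apply_le x 2

theorem enorm_radial_div_le {v : E3 → E3} (hv : Continuous v) {x : E3} (hx : r x ≠ 0) :
    ‖radial v x / r x‖ₑ ≤ eLpNorm (fun x => radial v x / r x) ⊤ volume := by
  refine enorm_le_eLpNorm_top_of_continuousAt (f := fun x => radial v x / r x) ?_
  have hr := continuous_r.continuousAt (x := x)
  have h1 : Continuous fun x : E3 => x 0 * v x 0 + x 1 * v x 1 := by fun_prop
  exact (h1.continuousAt.div hr hx).div hr hx

/-- The half-turn fixes the points of the axis and reverses horizontal vectors. -/
theorem axisymmetric_axis {v : E3 → E3} (hv : IsAxisymmetric v) {x : E3} (hx : x ∈ axis) :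
    v x 0 = 0 ∧ v x 1 = 0 := by
  have h1 : rotZ Real.pi x = x := by
    ext i
    fin_cases i <;> simp [rotZ, hx.1, hx.2]
  have h2 := hv Real.pi x
  rw [h1] at h2
  constructor
  · have := congrArg (fun y : E3 => y 0) h2
    simp [rotZ] at this
    linarith
  · have := congrArg (fun y : E3 => y 1) h2
    simp [rotZ] at this
    linarith

/-- Data of a velocity field satisfying the hypotheses of the theorem, apart from its
incompressibility. -/
structure IsAdmissible (T : ℝ) (u : ℝ → E3 → E3) : Prop where
  smooth : ContDiffOn ℝ ∞ (fun p : ℝ × E3 => u p.1 p.2) (Icc 0 T ×ˢ univ)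
  axisymmetric : ∀ t ∈ Icc 0 T, IsAxisymmetric (u t)
  vertical : ∀ᵐ τ ∂volume.restrict (Icc 0 T), ∀ x y, ‖u τ x 2 - u τ y 2‖ₑ ≤
    2 * (eLpNorm (hGrad (u τ)) 2 volume ^ (1 / 2 : ℝ) *
      eLpNorm (hGrad (curl (u τ))) 2 volume ^ (1 / 2 : ℝ))
  radialInt_lt : radialInt u T < ⊤
  hGradInt_lt : hGradInt u T < ⊤

/-- `X` is a trajectory on `[0, t]` of the field `θ u`. -/
def IsTrajectory (u : ℝ → E3 → E3) (θ : E3 → ℝ) (t : ℝ) (X : ℝ → E3) : Prop :=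
  ∀ s ∈ Icc 0 t, HasDerivAt X (θ (X s) • u s (X s)) s

theorem IsTrajectory.coord {u : ℝ → E3 → E3} {θ : E3 → ℝ} {t : ℝ} {X : ℝ → E3}
    (hX : IsTrajectory u θ t X) {s : ℝ} (hs : s ∈ Icc 0 t) (i : Fin 3) :
    HasDerivAt (fun s => X s i) (θ (X s) * u s (X s) i) s :=
  (EuclideanSpace.proj i : E3 →L[ℝ] ℝ).hasFDerivAt.comp_hasDerivAt s (hX s hs)

theorem IsTrajectory.continuousOn {u : ℝ → E3 → E3} {θ : E3 → ℝ} {t : ℝ} {X : ℝ → E3}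
    (hX : IsTrajectory u θ t X) : ContinuousOn X (Icc 0 t) :=
  fun s hs => (hX s hs).continuousAt.continuousWithinAt

theorem radialInt_mono {u : ℝ → E3 → E3} {s t : ℝ} (h : s ≤ t) : radialInt u s ≤ radialInt u t :=
  lintegral_mono_set (Icc_subset_Icc_right h)

theorem hGradInt_mono {u : ℝ → E3 → E3} {s t : ℝ} (h : s ≤ t) : hGradInt u s ≤ hGradInt u t :=
  lintegral_mono_set (Icc_subset_Icc_right h)

theorem IsTrajectory.continuousOn_velocity {T : ℝ} {u : ℝ → E3 → E3} (hu : IsAdmissible T u)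
    {θ : E3 → ℝ} (hθ : Continuous θ) {t : ℝ} (htT : t ≤ T) {X : ℝ → E3}
    (hX : IsTrajectory u θ t X) (i : Fin 3) :
    ContinuousOn (fun s => θ (X s) * u s (X s) i) (Icc 0 t) := by
  have h1 : ContinuousOn (fun s => u s (X s)) (Icc 0 t) :=
    hu.smooth.continuousOn.comp (continuousOn_id.prodMk hX.continuousOn)
      fun s hs => ⟨⟨hs.1, hs.2.trans htT⟩, trivial⟩
  have h2 : Continuous fun x : E3 => x i := by fun_prop
  exact (hθ.comp_continuousOn hX.continuousOn).mul (h2.comp_continuousOn h1)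

/-- Along trajectories, `log r` varies by at most `∫ ‖u_r / r‖_{L^∞}`. -/
theorem IsTrajectory.r_le {T : ℝ} {u : ℝ → E3 → E3} (hu : IsAdmissible T u)
    {θ : E3 → ℝ} (hθ : Continuous θ) (hθ01 : ∀ x, θ x ∈ Icc (0 : ℝ) 1) {t : ℝ} (htT : t ≤ T)
    {X : ℝ → E3} (hX : IsTrajectory u θ t X) {K : ℝ}
    (hK : ∀ s ∈ Icc 0 T, ∀ x, |θ x * (x 0 * u s x 0 + x 1 * u s x 1)| ≤ K * r x ^ 2)
    {a b : ℝ} (ha : a ∈ Icc 0 t) (hb : b ∈ Icc 0 t) :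
    r (X b) ≤ r (X a) * Real.exp (radialInt u t).toReal := by
  set f : ℝ → ℝ := fun s => r (X s) ^ 2 with hfdef
  set f' : ℝ → ℝ := fun s => 2 * (X s 0 * (θ (X s) * u s (X s) 0)
    + X s 1 * (θ (X s) * u s (X s) 1)) with hf'def
  have hf'eq : ∀ s, f' s = 2 * (θ (X s) * (X s 0 * u s (X s) 0 + X s 1 * u s (X s) 1)) :=
    fun s => by simp only [hf'def]; ring
  have hf : ∀ s ∈ Icc 0 t, HasDerivAt f (f' s) s := by
    intro s hs
    have h := ((hX.coord hs 0).pow 2).add ((hX.coord hs 1).pow 2)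
    convert! h using 1
    · ext s; simp only [hfdef, r_sq]; rfl
    · simp only [hf'def]; push_cast; ring
  have hmem : ∀ s ∈ Icc 0 t, s ∈ Icc 0 T := fun s hs => ⟨hs.1, hs.2.trans htT⟩
  have hfK : ∀ s ∈ Icc 0 t, |f' s| ≤ (2 * K) * f s := by
    intro s hs
    rw [hf'eq, abs_mul, abs_two, mul_assoc]
    exact mul_le_mul_of_nonneg_left (hK s (hmem s hs) _) two_pos.le
  have hf0 : ∀ s, 0 ≤ f s := fun s => sq_nonneg _
  -- The constant K may depend on the cutoff; it is used only to separate trajectories on the axis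
  -- from those off it, so that log r makes sense. The rate in the conclusion comes from `radialInt`
  -- alone.
  rcases (r_nonneg (X a)).eq_or_lt with h0 | h0
  · have h := le_mul_exp_of_abs_deriv_le hf hfK ha hb
    have h1 : r (X b) ^ 2 ≤ 0 := by
      have : f a = 0 := by simp [hfdef, ← h0]
      rw [this, zero_mul] at h
      exact h
    rw [← h0, zero_mul]
    exact (pow_eq_zero_iff two_ne_zero).1 (le_antisymm h1 (sq_nonneg _)) |>.le
  · have hpos : ∀ s ∈ Icc 0 t, 0 < f s := by
      intro s hs
      refine (hf0 s).lt_of_ne fun h => ?_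
      have h1 := le_mul_exp_of_abs_deriv_le hf hfK hs ha
      rw [← h, zero_mul] at h1
      have h2 : 0 < f a := by positivity
      linarith
    have hrpos : ∀ s ∈ Icc 0 t, r (X s) ≠ 0 := fun s hs h => by
      have := hpos s hs
      simp [hfdef, h] at this
    have hlog : ∀ s ∈ Icc 0 t, HasDerivAt (fun s => Real.log (f s) / 2) (f' s / f s / 2) s :=
      fun s hs => ((hf s hs).log (hpos s hs).ne').div_const 2
    have hf'c : ContinuousOn f' (Icc 0 t) := by
      have h0 := hX.continuousOn_velocity hu hθ htT 0
      have h1 := hX.continuousOn_velocity hu hθ htT 1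
      have hc : ∀ i : Fin 3, ContinuousOn (fun s => X s i) (Icc 0 t) := fun i s hs =>
        (hX.coord hs i).continuousAt.continuousWithinAt
      exact continuousOn_const.mul (((hc 0).mul h0).add ((hc 1).mul h1))
    have hfc : ContinuousOn f (Icc 0 t) := fun s hs => (hf s hs).continuousAt.continuousWithinAt
    have hbound := abs_sub_le_toReal_lintegral hlog
      ((hf'c.div hfc fun s hs => (hpos s hs).ne').div_const 2)
      (g := fun s => eLpNorm (fun x => radial (u s) x / r x) ⊤ volume) ?_
      ((radialInt_mono htT).trans_lt hu.radialInt_lt) ha hb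
    · have h1 : Real.log (f b) / 2 - Real.log (f a) / 2 ≤ (radialInt u t).toReal :=
        (le_abs_self _).trans hbound
      have hl : ∀ s ∈ Icc 0 t, Real.log (f s) / 2 = Real.log (r (X s)) := by
        intro s hs
        simp only [hfdef]
        rw [Real.log_pow]
        push_cast
        ring
      rw [hl a ha, hl b hb] at h1
      have hra := h0
      have hrb : 0 < r (X b) := (r_nonneg _).lt_of_ne (hrpos b hb).symm
      rw [← Real.log_le_log_iff hrb (by positivity), Real.log_mul hra.ne' (Real.exp_ne_zero _),
        Real.log_exp]
      linarith
    · refine (ae_restrict_iff' measurableSet_Icc).2 (Filter.Eventually.of_forall fun s hs => ?_)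
      have hv := (contDiff_slice hu.smooth (hmem s hs)).continuous
      refine le_trans ?_ (enorm_radial_div_le hv (hrpos s hs))
      rw [Real.enorm_eq_ofReal_abs, Real.enorm_eq_ofReal_abs]
      refine ENNReal.ofReal_le_ofReal ?_
      have e : f' s / f s / 2 = θ (X s) * (radial (u s) (X s) / r (X s)) := by
        rw [hf'eq, radial]
        simp only [hfdef]
        have := hrpos s hs
        field_simp
      rw [e, abs_mul, abs_of_nonneg (hθ01 _).1]
      exact mul_le_of_le_one_left (abs_nonneg _) (hθ01 _).2

/-- The vertical displacement along a trajectory is bounded independently of the cutoff. -/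
theorem IsTrajectory.abs_vertical_sub_le {T : ℝ} {u : ℝ → E3 → E3} (hu : IsAdmissible T u)
    {θ : E3 → ℝ} (hθ : Continuous θ) (hθ01 : ∀ x, θ x ∈ Icc (0 : ℝ) 1) {t : ℝ} (htT : t ≤ T)
    {X : ℝ → E3} (hX : IsTrajectory u θ t X) {c : ℝ}
    (hc : ∀ s ∈ Icc 0 T, |u s 0 2| ≤ c) {a b : ℝ} (ha : a ∈ Icc 0 t) (hb : b ∈ Icc 0 t) :
    |X b 2 - X a 2| ≤ (ENNReal.ofReal c * ENNReal.ofReal t + 2 * hGradInt u t).toReal := by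
  have hH : hGradInt u t < ⊤ := (hGradInt_mono htT).trans_lt hu.hGradInt_lt
  have hint : ∫⁻ s in Icc 0 t, (ENNReal.ofReal c + 2 * (eLpNorm (hGrad (u s)) 2 volume ^ (1 / 2 : ℝ)
      * eLpNorm (hGrad (curl (u s))) 2 volume ^ (1 / 2 : ℝ)))
      = ENNReal.ofReal c * ENNReal.ofReal t + 2 * hGradInt u t := by
    rw [lintegral_add_left measurable_const, lintegral_const_mul' _ _ (by simp), hGradInt]
    simp
  have h := abs_sub_le_toReal_lintegral (fun s hs => hX.coord hs 2)
    (hX.continuousOn_velocity hu hθ htT 2) (g := fun s => ENNReal.ofReal c +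
      2 * (eLpNorm (hGrad (u s)) 2 volume ^ (1 / 2 : ℝ) *
      eLpNorm (hGrad (curl (u s))) 2 volume ^ (1 / 2 : ℝ))) ?_ ?_ ha hb
  · rwa [hint] at h
  · have hae := ae_restrict_of_ae_restrict_of_subset (Icc_subset_Icc_right htT) hu.vertical
    filter_upwards [hae, self_mem_ae_restrict measurableSet_Icc] with s hs hs'
    have h1 : ‖θ (X s) * u s (X s) 2‖ₑ ≤ ‖u s (X s) 2‖ₑ := by
      rw [Real.enorm_eq_ofReal_abs, Real.enorm_eq_ofReal_abs, abs_mul, abs_of_nonneg (hθ01 _).1]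
      exact ENNReal.ofReal_le_ofReal (mul_le_of_le_one_left (abs_nonneg _) (hθ01 _).2)
    refine h1.trans ?_
    -- Only differences of the vertical component are controlled, so the velocity at the origin
    -- serves as a reference value.
    rw [show u s (X s) 2 = u s 0 2 + (u s (X s) 2 - u s 0 2) by ring]
    refine (enorm_add_le _ _).trans (add_le_add ?_ (hs _ _))
    rw [Real.enorm_eq_ofReal_abs]
    exact ENNReal.ofReal_le_ofReal (hc s ⟨hs'.1, hs'.2.trans htT⟩)
  · rw [hint]
    exact ENNReal.add_lt_top.2 ⟨ENNReal.mul_lt_top ENNReal.ofReal_lt_top ENNReal.ofReal_lt_top,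
      ENNReal.mul_lt_top (by simp) hH⟩

/-- Two trajectories separate vertically by at most `2 ∫ ‖∇_h u‖^{1/2} ‖∇_h ω‖^{1/2}`. -/
theorem IsTrajectory.abs_vertical_sub_sub_le {T : ℝ} {u : ℝ → E3 → E3} (hu : IsAdmissible T u)
    {θ : E3 → ℝ} (hθ : Continuous θ) {t : ℝ} (htT : t ≤ T) {X Y : ℝ → E3}
    (hX : IsTrajectory u θ t X) (hY : IsTrajectory u θ t Y) (hX1 : ∀ s ∈ Icc 0 t, θ (X s) = 1)
    (hY1 : ∀ s ∈ Icc 0 t, θ (Y s) = 1) {a b : ℝ} (ha : a ∈ Icc 0 t) (hb : b ∈ Icc 0 t) :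
    |(X b 2 - Y b 2) - (X a 2 - Y a 2)| ≤ (2 * hGradInt u t).toReal := by
  have hH : hGradInt u t < ⊤ := (hGradInt_mono htT).trans_lt hu.hGradInt_lt
  have hint : ∫⁻ s in Icc 0 t, 2 * (eLpNorm (hGrad (u s)) 2 volume ^ (1 / 2 : ℝ)
      * eLpNorm (hGrad (curl (u s))) 2 volume ^ (1 / 2 : ℝ)) = 2 * hGradInt u t := by
    rw [lintegral_const_mul' _ _ (by simp), hGradInt]
  rw [← hint]
  refine abs_sub_le_toReal_lintegral (f := fun s => X s 2 - Y s 2)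
    (fun s hs => (hX.coord hs 2).sub (hY.coord hs 2))
    ((hX.continuousOn_velocity hu hθ htT 2).sub (hY.continuousOn_velocity hu hθ htT 2)) ?_ ?_ ha hb
  · have hae := ae_restrict_of_ae_restrict_of_subset (Icc_subset_Icc_right htT) hu.vertical
    filter_upwards [hae, self_mem_ae_restrict measurableSet_Icc] with s hs hs'
    rw [hX1 s hs', hY1 s hs', one_mul, one_mul]
    exact hs _ _
  · rw [hint]
    exact ENNReal.mul_lt_top (by simp) hH

/-! ### From integrals against test functions to measures and densities -/

/-- A homeomorphism which preserves the integrals of the test functions supported in a bounded open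
set preserves Lebesgue measure there. -/
theorem map_restrict_eq_of_integral_eq {e : E3 ≃ₜ E3} {B : Set E3} (hB : IsOpen B)
    (hBb : Bornology.IsBounded B)
    (h : ∀ χ : E3 → ℝ, ContDiff ℝ ∞ χ → HasCompactSupport χ → Function.support χ ⊆ B →
      ∫ x, χ (e x) = ∫ x, χ x) :
    (volume.map e).restrict B = volume.restrict B := by
  have hfinB : ∀ V ⊆ B, volume V < ⊤ := fun V hV => (hBb.subset hV).measure_lt_top
  have hfine : ∀ V ⊆ B, volume (e ⁻¹' V) < ⊤ := by
    intro V hV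
    have hc : IsCompact (closure B) := hBb.isCompact_closure
    have : e ⁻¹' V ⊆ e.symm '' closure B := fun x hx =>
      ⟨e x, subset_closure (hV hx), e.symm_apply_apply x⟩
    exact (measure_mono this).trans_lt (hc.image e.symm.continuous).measure_lt_top
  -- The functions 1 − (1 − f)^n converge pointwise to the indicator of the set where f > 0. For f
  -- smooth they are admissible test functions, which gives the measure of any open subset of B.
  have hlim : ∀ (f : E3 → ℝ) (V : Set E3), Continuous f → IsOpen V → volume V < ⊤ →
      Function.support f = V → (∀ x, f x ∈ Icc (0 : ℝ) 1) →
      Filter.Tendsto (fun n : ℕ => ∫ x, (1 - (1 - f x) ^ n)) Filter.atTop (𝓝 (volume.real V)) := by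
    intro f V hf hV hVfin hs hf01
    have h1 : volume.real V = ∫ x, V.indicator (fun _ => (1 : ℝ)) x := by
      rw [integral_indicator hV.measurableSet]; simp
    have h0 : ∀ x ∉ V, f x = 0 := fun x hx => by
      rwa [← hs, Function.notMem_support] at hx
    rw [h1]
    refine tendsto_integral_of_dominated_convergence (V.indicator fun _ => (1 : ℝ))
      (fun n => (by fun_prop : Continuous fun x => 1 - (1 - f x) ^ n).aestronglyMeasurable) ?_ ?_ ?_
    · rw [integrable_indicator_iff hV.measurableSet]
      exact integrableOn_const hVfin.ne
    · intro n
      refine Filter.Eventually.of_forall fun x => ?_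
      by_cases hx : x ∈ V
      · have h2 : 0 ≤ (1 - f x) ^ n := pow_nonneg (by linarith [(hf01 x).2]) n
        have h3 : (1 - f x) ^ n ≤ 1 :=
          pow_le_one₀ (by linarith [(hf01 x).2]) (by linarith [(hf01 x).1])
        rw [indicator_of_mem hx, Real.norm_eq_abs, abs_le]
        constructor <;> linarith
      · simp [hx, h0 x hx]
    · refine Filter.Eventually.of_forall fun x => ?_
      by_cases hx : x ∈ V
      · have hpos : 0 < f x := (hf01 x).1.lt_of_ne fun h => by
          rw [← hs, Function.mem_support] at hx
          exact hx h.symm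
        have := tendsto_pow_atTop_nhds_zero_of_lt_one (r := 1 - f x) (by linarith [(hf01 x).2])
          (by linarith)
        simpa [hx] using this.const_sub 1
      · simp [hx, h0 x hx]
  have hopen : ∀ V, IsOpen V → V ⊆ B → volume (e ⁻¹' V) = volume V := by
    intro V hV hVB
    obtain ⟨f, hfs, hf, hf01⟩ := hV.exists_contDiff_support_eq (n := ⊤)
    have hf01' : ∀ x, f x ∈ Icc (0 : ℝ) 1 := fun x => hf01 ⟨x, rfl⟩
    have h1 := hlim f V hf.continuous hV (hfinB V hVB) hfs hf01'
    have h2 := hlim (fun x => f (e x)) (e ⁻¹' V) (hf.continuous.comp e.continuous)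
      (hV.preimage e.continuous) (hfine V hVB) (by ext x; simp [← hfs]) fun x => hf01' _
    have h3 : ∀ n : ℕ, 1 ≤ n → ∫ x, (1 - (1 - f (e x)) ^ n) = ∫ x, (1 - (1 - f x) ^ n) := by
      intro n hn
      have hsub : Function.support (fun x => 1 - (1 - f x) ^ n) ⊆ V := by
        intro x hx
        rw [← hfs, Function.mem_support]
        intro h0
        simp [h0] at hx
      refine h (fun x => 1 - (1 - f x) ^ n) (contDiff_const.sub ((contDiff_const.sub hf).pow n)) ?_
        (hsub.trans hVB)
      refine HasCompactSupport.intro hBb.isCompact_closure fun x hx => ?_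
      by_contra hne
      exact hx (subset_closure (hVB (hsub hne)))
    have h4 : volume.real (e ⁻¹' V) = volume.real V :=
      tendsto_nhds_unique (h2.congr' (Filter.eventually_atTop.2 ⟨1, h3⟩)) h1
    exact (measureReal_eq_measureReal_iff (hfine V hVB).ne (hfinB V hVB).ne).1 h4
  have hmap : ∀ V, MeasurableSet V → (volume.map e).restrict B V = volume (e ⁻¹' (V ∩ B)) := by
    intro V hV
    rw [Measure.restrict_apply hV, Measure.map_apply e.measurable (hV.inter hB.measurableSet)]
  have : IsFiniteMeasure ((volume.map e).restrict B) :=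
    ⟨by rw [hmap _ MeasurableSet.univ]; exact hfine _ inter_subset_right⟩
  refine ext_of_generate_finite {s | IsOpen s} (BorelSpace.measurable_eq) isPiSystem_isOpen
    (fun V hV => ?_) ?_
  · have hV' : IsOpen V := hV
    rw [hmap V hV'.measurableSet, hopen _ (hV'.inter hB) inter_subset_right,
      Measure.restrict_apply hV'.measurableSet]
  · rw [hmap _ MeasurableSet.univ, univ_inter, hopen B hB le_rfl]
    simp

/-- Two functions, one of them composed with a homeomorphism preserving Lebesgue measure on an open
set, agree if they have the same integrals against test functions. -/
theorem ae_eq_comp_symm_of_integral_eq {e : E3 ≃ₜ E3} {B : Set E3} (hB : IsOpen B)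
    (hBb : Bornology.IsBounded B) (he : (volume.map e).restrict B = volume.restrict B)
    {f g : E3 → ℝ} (hf : LocallyIntegrable f volume) (hg : LocallyIntegrable g volume)
    (h : ∀ χ : E3 → ℝ, ContDiff ℝ ∞ χ → HasCompactSupport χ → Function.support χ ⊆ B →
      ∫ x, f x * χ x = ∫ x, g x * χ (e x)) :
    f =ᵐ[volume.restrict B] g ∘ e.symm := by
  have hmp : MeasurePreserving e (volume.restrict (e ⁻¹' B)) (volume.restrict B) := by
    refine ⟨e.measurable, ?_⟩
    rw [← he, Measure.restrict_map e.measurable hB.measurableSet]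
  have hemb := e.measurableEmbedding
  have hgi : IntegrableOn (g ∘ e.symm) B volume := by
    have h1 : IntegrableOn g (e ⁻¹' B) volume := by
      have hc : IsCompact (e.symm '' closure B) :=
        hBb.isCompact_closure.image e.symm.continuous
      refine (hg.integrableOn_isCompact hc).mono_set fun x hx => ?_
      exact ⟨e x, subset_closure hx, e.symm_apply_apply x⟩
    rw [IntegrableOn, ← hmp.integrable_comp_emb hemb]
    have h2 : (g ∘ e.symm) ∘ e = g := funext fun x => by simp
    rw [h2]
    exact h1
  have hkey : ∀ᵐ x, x ∈ B → f x - (g ∘ e.symm) x = 0 := by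
    refine hB.ae_eq_zero_of_integral_contDiff_smul_eq_zero
      ((hf.locallyIntegrableOn B).sub hgi.locallyIntegrableOn) fun χ hχ hχc hχB => ?_
    have hsupp : Function.support χ ⊆ B := (subset_tsupport χ).trans hχB
    have hχ0 : ∀ x ∉ B, χ x = 0 := fun x hx => by
      by_contra hne
      exact hx (hsupp hne)
    have h1 : Integrable fun x => χ x * f x :=
      hf.integrable_smul_left_of_hasCompactSupport hχ.continuous hχc
    have h2 : Integrable fun x => χ x * (g ∘ e.symm) x := by
      obtain ⟨C, hC⟩ := hχc.exists_bound_of_continuous hχ.continuous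
      have : IntegrableOn (fun x => χ x * (g ∘ e.symm) x) B :=
        Integrable.bdd_mul hgi hχ.continuous.aestronglyMeasurable
          (Filter.Eventually.of_forall hC)
      exact (integrableOn_iff_integrable_of_support_subset fun x hx => by
        by_contra hne
        exact hx (by simp [hχ0 x hne])).1 this
    simp only [smul_eq_mul, mul_sub]
    rw [integral_sub h1 h2, sub_eq_zero]
    calc ∫ x, χ x * f x = ∫ x, f x * χ x := by simp only [mul_comm]
      _ = ∫ x, g x * χ (e x) := h χ hχ hχc hsupp
      _ = ∫ x in e ⁻¹' B, g x * χ (e x) :=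
        (setIntegral_eq_integral_of_forall_compl_eq_zero fun x hx => by
          rw [hχ0 (e x) hx, mul_zero]).symm
      _ = ∫ x in e ⁻¹' B, (fun y => χ y * (g ∘ e.symm) y) (e x) := by
        refine integral_congr_ae (Filter.Eventually.of_forall fun x => ?_)
        simp [mul_comm]
      _ = ∫ x in B, χ x * (g ∘ e.symm) x := hmp.integral_comp hemb fun x => χ x * (g ∘ e.symm) x
      _ = ∫ x, χ x * (g ∘ e.symm) x :=
        setIntegral_eq_integral_of_forall_compl_eq_zero fun x hx => by rw [hχ0 x hx, zero_mul]
  refine (ae_restrict_iff' hB.measurableSet).2 ?_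
  filter_upwards [hkey] with x hx hxB
  exact sub_eq_zero.1 (hx hxB)

/-- The left side is Lebesgue measure restricted to the preimage of B under e. -/
theorem map_symm_restrict_le {e : E3 ≃ₜ E3} {B : Set E3} (hB : MeasurableSet B)
    (he : (volume.map e).restrict B = volume.restrict B) :
    (volume.restrict B).map e.symm ≤ volume := by
  rw [← he, Measure.restrict_map e.measurable hB,
    Measure.map_map e.symm.measurable e.measurable]
  simp [Measure.restrict_le_self]

/-! ### Representation of the weak solution by the backward flow -/

/-- The weighted bound `|x_h · û_h| ≤ K r²` for a Lipschitz field `û` that is vertical on the axis. -/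
theorem abs_horizontal_le {v : E3 → E3} {K : NNReal} (hv : LipschitzWith K v)
    (hax : ∀ x ∈ axis, v x 0 = 0 ∧ v x 1 = 0) (x : E3) :
    |x 0 * v x 0 + x 1 * v x 1| ≤ K * r x ^ 2 := by
  -- The orthogonal projection of x onto the axis: v has no horizontal part there, so the Lipschitz
  -- bound gives a horizontal part of v at x of size at most K r.
  set x' : E3 := EuclideanSpace.single 2 (x 2) with hx'
  have hx'a : x' ∈ axis := by simp [axis, hx']
  obtain ⟨h0, h1⟩ := hax x' hx'a
  have hd : dist x x' = r x := by
    rw [EuclideanSpace.dist_eq, Fin.sum_univ_three, r]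
    simp [hx']
  have hl := hv.dist_le_mul x x'
  rw [hd, dist_eq_norm] at hl
  have hr : r (v x - v x') ≤ K * r x := (r_le_norm _).trans hl
  have hrr : r (v x - v x') = r (v x) := by simp [r, h0, h1]
  rw [hrr] at hr
  have hcs : |x 0 * v x 0 + x 1 * v x 1| ≤ r x * r (v x) := by
    refine abs_le_of_sq_le_sq ?_ (mul_nonneg (r_nonneg _) (r_nonneg _))
    rw [mul_pow, r_sq, r_sq]
    nlinarith [sq_nonneg (x 0 * v x 1 - x 1 * v x 0)]
  calc _ ≤ r x * (K * r x) := hcs.trans (mul_le_mul_of_nonneg_left hr (r_nonneg x))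
    _ = _ := by ring

/-- The space-time field `(1, û)`. -/
theorem IsGlobalFlow.fst_eq {v : ℝ × E3 → E3} {Φ : ℝ → ℝ × E3 → ℝ × E3}
    (hΦ : IsGlobalFlow (fun p => ((1 : ℝ), v p)) Φ) (s : ℝ) (p : ℝ × E3) :
    (Φ s p).1 = p.1 + s := by
  have hd : ∀ s, HasDerivAt (fun s => (Φ s p).1 - s) 0 s := by
    intro s
    have h1 : HasDerivAt (fun s => (Φ s p).1) 1 s :=
      (ContinuousLinearMap.fst ℝ ℝ E3).hasFDerivAt.comp_hasDerivAt s (hΦ.hasDerivAt p s)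
    rw [← sub_self (1 : ℝ)]
    exact h1.sub (hasDerivAt_id s)
  have h := is_const_of_deriv_eq_zero (fun s => (hd s).differentiableAt) (fun s => (hd s).deriv) s 0
  simp only [hΦ.map_zero, sub_zero] at h
  linarith

theorem IsGlobalFlow.hasDerivAt_snd {v : ℝ × E3 → E3} {Φ : ℝ → ℝ × E3 → ℝ × E3}
    (hΦ : IsGlobalFlow (fun p => ((1 : ℝ), v p)) Φ) (p : ℝ × E3) (s : ℝ) :
    HasDerivAt (fun s => (Φ (s - p.1) p).2) (v (s, (Φ (s - p.1) p).2)) s := by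
  have h1 : HasDerivAt (fun s => (Φ s p).2) (v (Φ (s - p.1) p)) (s - p.1) :=
    (ContinuousLinearMap.snd ℝ ℝ E3).hasFDerivAt.comp_hasDerivAt _ (hΦ.hasDerivAt p (s - p.1))
  have h2 := h1.comp_sub_const s p.1
  have h3 : Φ (s - p.1) p = (s, (Φ (s - p.1) p).2) := Prod.ext (by rw [hΦ.fst_eq]; simp) rfl
  rwa [h3] at h2

/-- On a ball, the solution at time `t` is the initial value composed with the backward flow; the
flow preserves volume and obeys the bounds on the distance to the axis and on heights. -/
theorem IsTransportSolution.exists_backward_map {T : ℝ} {u : ℝ → E3 → E3} {ρ₀ : E3 → ℝ}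
    {ρ : ℝ → E3 → ℝ} (hu : IsAdmissible T u) (hdiv : ∀ t ∈ Icc 0 T, ∀ x, div (u t) x = 0)
    (hρ : IsTransportSolution T u ρ₀ ρ) (hρ₀ : LocallyIntegrable ρ₀ volume) {t : ℝ}
    (ht : t ∈ Icc 0 T) {k : ℝ} (hk : 0 < k) :
    ∃ P : E3 → E3, Measurable P ∧ (volume.restrict (Metric.ball 0 k)).map P ≤ volume ∧
      ρ t =ᵐ[volume.restrict (Metric.ball 0 k)] ρ₀ ∘ P ∧
      (∀ x ∈ Metric.ball (0 : E3) k, r (P x) ≤ r x * Real.exp (radialInt u t).toReal) ∧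
      ∀ x ∈ Metric.ball (0 : E3) k, ∀ y ∈ Metric.ball (0 : E3) k,
        |x 2 - y 2| ≤ |P x 2 - P y 2| + (2 * hGradInt u t).toReal := by
  have hT : 0 ≤ T := ht.1.trans ht.2
  obtain ⟨c, hc⟩ : ∃ c, ∀ s ∈ Icc 0 T, |u s 0 2| ≤ c := by
    have h1 : ContinuousOn (fun s => u s 0) (Icc 0 T) :=
      hu.smooth.continuousOn.comp (continuousOn_id.prodMk continuousOn_const)
        fun s hs => ⟨hs, trivial⟩
    obtain ⟨c, hc⟩ := isCompact_Icc.exists_bound_of_continuousOn h1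
    exact ⟨c, fun s hs => (abs_vertical_le_norm _).trans (hc s hs)⟩
  set G := (radialInt u T).toReal
  set D := (ENNReal.ofReal c * ENNReal.ofReal T + 2 * hGradInt u T).toReal
  have hD0 : 0 ≤ D := ENNReal.toReal_nonneg
  -- A trajectory meeting the ball of radius k at some time of [0, T] has r ≤ k e^G and |z| ≤ k + D
  -- throughout. Neither bound involves the cutoff, so R can be fixed before the cutoff is chosen.
  set R := k * Real.exp G + k + D with hR
  have hR0 : 0 < R := by positivity
  -- Of the margin 2, one unit allows for the motion during a time δ outside [0, T], the other for
  -- the enlargement of the support radius by δ ≤ 1.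
  obtain ⟨θ, K, L, hθ, hθ01, hθ1, hvK, hvL⟩ := exists_cutoff_field hT hu.smooth
    (R := R + 2) (by linarith)
  set v : ℝ × E3 → E3 := fun p => θ p.2 • u (clampTime T p.1) p.2 with hv
  set W : ℝ × E3 → ℝ × E3 := fun p => (1, v p) with hWdef
  have hWK : LipschitzWith (max 0 K) W := (LipschitzWith.const (1 : ℝ)).prodMk hvK
  have hWL : ∀ p, ‖W p‖ ≤ (max 1 L : NNReal) := fun p => by
    rw [Prod.norm_def, NNReal.coe_max]
    exact max_le_max (by simp [hWdef]) (hvL p)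
  obtain ⟨Φ, hΦ⟩ := exists_isGlobalFlow hWK hWL
  have hfst : ∀ s p, (Φ s p).1 = p.1 + s := fun s p => hΦ.fst_eq s p
  have hK : ∀ s ∈ Icc 0 T, ∀ x, |θ x * (x 0 * u s x 0 + x 1 * u s x 1)| ≤ K * r x ^ 2 := by
    intro s hs x
    have hvs : LipschitzWith K fun x => v (s, x) := by
      have h := hvK.comp (LipschitzWith.prodMk_left s)
      rw [mul_one] at h
      exact h
    have := abs_horizontal_le hvs (fun x hx => by
      have := axisymmetric_axis (hu.axisymmetric s hs) hx
      simp [hv, clampTime_of_mem hs, this.1, this.2]) x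
    simp only [hv, clampTime_of_mem hs, PiLp.smul_apply, smul_eq_mul] at this
    refine (le_of_eq ?_).trans this
    congr 1
    ring
  have htraj : ∀ p : ℝ × E3, IsTrajectory u θ T fun s => (Φ (s - p.1) p).2 := by
    intro p s hs
    have := hΦ.hasDerivAt_snd p s
    simpa only [hv, clampTime_of_mem hs] using this
  have hconf : ∀ p : ℝ × E3, ∀ s₀ ∈ Icc 0 T, ‖(Φ (s₀ - p.1) p).2‖ ≤ k →
      ∀ s ∈ Icc 0 T, ‖(Φ (s - p.1) p).2‖ ≤ R := by
    intro p s₀ hs₀ hk₀ s hs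
    have h1 := (htraj p).r_le hu hθ hθ01 le_rfl hK hs₀ hs
    have h2 := (htraj p).abs_vertical_sub_le hu hθ hθ01 le_rfl hc hs₀ hs
    have h3 : r (Φ (s₀ - p.1) p).2 * Real.exp G ≤ k * Real.exp G :=
      mul_le_mul_of_nonneg_right ((r_le_norm _).trans hk₀) (Real.exp_pos _).le
    have h4 := (abs_vertical_le_norm _).trans hk₀
    have h5 := abs_sub_abs_le_abs_sub ((Φ (s - p.1) p).2 2) ((Φ (s₀ - p.1) p).2 2)
    refine (norm_le_r_add _).trans ?_
    simp only at h1 h2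
    linarith
  have hΦc := hΦ.continuous_map hWK hWL
  let e : E3 ≃ₜ E3 :=
    { toFun := fun x => (Φ t (0, x)).2
      invFun := fun x => (Φ (-t) (t, x)).2
      left_inv := fun x => by
        have h1 : (t, (Φ t (0, x)).2) = Φ t (0, x) := Prod.ext (by simp [hfst]) rfl
        simp only [h1, hΦ.map_neg_map hWK]
      right_inv := fun x => by
        have h1 : (0, (Φ (-t) (t, x)).2) = Φ (-t) (t, x) := Prod.ext (by simp [hfst]) rfl
        have h2 := hΦ.map_neg_map hWK (-t) (t, x)
        rw [neg_neg] at h2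
        simp only [h1, h2]
      continuous_toFun := by have := hΦc t; fun_prop
      continuous_invFun := by have := hΦc (-t); fun_prop }
  have hXt : ∀ x, (Φ (t - t) (t, x)).2 = x := fun x => by rw [sub_self, hΦ.map_zero]
  -- The test function sends p to the value of χ at the position reached at time t by the trajectory
  -- through p. It is constant along the flow, equal to χ at time t and to χ∘e at time 0. A general
  -- solution f is allowed so that both ρ and the constant 1 can be inserted.
  have hdual : ∀ (f₀ : E3 → ℝ) (f : ℝ → E3 → ℝ), IsTransportSolution T u f₀ f →
      LocallyIntegrable f₀ volume → ∀ χ : E3 → ℝ, ContDiff ℝ ∞ χ → HasCompactSupport χ →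
      Function.support χ ⊆ Metric.ball 0 k → ∫ x, f t x * χ x = ∫ x, f₀ x * χ (e x) := by
    intro f₀ f hf hf₀ χ hχ hχc hχk
    have hχ0 : ∀ x : E3, k < ‖x‖ → χ x = 0 := fun x hx => by
      by_contra hne
      have := mem_ball_zero_iff.1 (hχk hne)
      linarith
    obtain ⟨C, hC⟩ := hχ.lipschitzWith_of_hasCompactSupport hχc (by simp)
    set M : NNReal := max 1 L
    set N : NNReal := max 0 K
    have hM0 : (0 : ℝ) ≤ M := M.coe_nonneg
    have hspeed : ∀ (p : ℝ × E3) (s s' : ℝ), ‖(Φ s p).2‖ ≤ ‖(Φ s' p).2‖ + M * |s - s'| := by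
      intro p s s'
      have h1 := hΦ.dist_time_le hWL p s s'
      have h2 : dist (Φ s p).2 (Φ s' p).2 ≤ dist (Φ s p) (Φ s' p) := le_max_right _ _
      have h3 := norm_sub_norm_le (Φ s p).2 (Φ s' p).2
      rw [← dist_eq_norm] at h3
      linarith
    have hχk' : ∀ p : ℝ × E3, χ (Φ (t - p.1) p).2 ≠ 0 → ‖(Φ (t - p.1) p).2‖ ≤ k :=
      fun p hp => not_lt.1 fun h => hp (hχ0 _ h)
    -- As M bounds the speed, a trajectory moves by at most 1 during a time δ; times within δ of [0,
    -- T] can thus be brought back to it.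
    have hδ : 0 < 1 / ((M : ℝ) + 1) := by positivity
    have hδ1 : 1 / ((M : ℝ) + 1) ≤ 1 := by
      rw [div_le_one (by positivity)]; linarith
    have hMδ : (M : ℝ) * (1 / (M + 1)) ≤ 1 := by
      rw [mul_one_div, div_le_one (by positivity)]; linarith
    have hΦu := hΦ.continuous_uncurry hWK hWL
    have h := hf.integral_mul_eq hf₀ hΦ hWK hWL (φ := fun p => χ (Φ (t - p.1) p).2)
      (R := R + 1) (R' := k + M * (2 * T + 2)) (δ := 1 / (M + 1)) ?_ ?_ ?_ hδ ?_ ?_ ?_ ht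
    · simp only [hXt, sub_zero] at h
      exact h
    · have h1 : Continuous fun p : ℝ × E3 => Function.uncurry Φ (t - p.1, p) :=
        hΦu.comp (by fun_prop)
      exact hχ.continuous.comp (continuous_snd.comp h1)
    · intro s p
      simp only [hfst]
      rw [← hΦ.map_add hWK]
      congr 3
      ring
    · intro A
      refine ⟨C * (Real.exp (N * (|t| + A)) + M), by positivity, fun p q hp hq => ?_⟩
      have h1 := hC.dist_le_mul (Φ (t - p.1) p).2 (Φ (t - q.1) q).2
      rw [Real.dist_eq] at h1
      refine h1.trans ?_
      rw [mul_assoc]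
      refine mul_le_mul_of_nonneg_left ?_ C.coe_nonneg
      have h2 : dist (Φ (t - p.1) p).2 (Φ (t - q.1) q).2 ≤ dist (Φ (t - p.1) p) (Φ (t - q.1) q) :=
        le_max_right _ _
      have h3 := dist_triangle (Φ (t - p.1) p) (Φ (t - p.1) q) (Φ (t - q.1) q)
      have h4 := hΦ.dist_le_exp hWK p q (t - p.1)
      have h5 := hΦ.dist_time_le hWL q (t - p.1) (t - q.1)
      have h6 : |t - p.1 - (t - q.1)| ≤ dist p q := by
        have : dist p.1 q.1 ≤ dist p q := le_max_left _ _
        rw [Real.dist_eq] at this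
        rwa [show t - p.1 - (t - q.1) = -(p.1 - q.1) by ring, abs_neg]
      have h7 : |t - p.1| ≤ |t| + A := (abs_sub _ _).trans (by linarith)
      have h8 : Real.exp (N * |t - p.1|) ≤ Real.exp (N * (|t| + A)) :=
        Real.exp_le_exp.2 (mul_le_mul_of_nonneg_left h7 N.coe_nonneg)
      have h9 := mul_le_mul_of_nonneg_left h8 (dist_nonneg (x := p) (y := q))
      have h10 := mul_le_mul_of_nonneg_left h6 hM0
      linarith
    · intro p hp1 hp2
      by_contra hne
      have h1 := hχk' p hne
      have h2 := hspeed p 0 (t - p.1)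
      rw [hΦ.map_zero] at h2
      have h3 : |0 - (t - p.1)| ≤ 2 * T + 2 := by
        rw [abs_le] at hp1 ⊢
        constructor <;> linarith [hp1.1, hp1.2, ht.1, ht.2]
      have h4 := mul_le_mul_of_nonneg_left h3 hM0
      linarith
    · intro p hp1 hp2
      by_contra hne
      have h1 := hconf p t ht (hχk' p hne) (clampTime T p.1) (clampTime_mem hT _)
      have h2 := hspeed p 0 (clampTime T p.1 - p.1)
      rw [hΦ.map_zero] at h2
      have h3 : |0 - (clampTime T p.1 - p.1)| ≤ 1 / (M + 1) := by
        have h0 := hp1.1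
        have h0' := hp1.2
        rw [abs_le, clampTime]
        rcases max_cases 0 (min T p.1) with h | h <;> rcases min_cases T p.1 with h' | h' <;>
          constructor <;> linarith [h.1, h.2, h'.1, h'.2]
      have h4 := mul_le_mul_of_nonneg_left h3 hM0
      linarith
    · intro τ hτ x hx
      simp only [hWdef, hv, clampTime_of_mem hτ]
      rw [hθ1 x (by linarith), one_smul]
  have hball : IsOpen (Metric.ball (0 : E3) k) := Metric.isOpen_ball
  -- Liouville's theorem by duality with the constant density 1.
  have hpres : (volume.map e).restrict (Metric.ball 0 k) = volume.restrict (Metric.ball 0 k) := by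
    refine map_restrict_eq_of_integral_eq hball Metric.isBounded_ball fun χ h1 h2 h3 => ?_
    have := hdual _ _ (isTransportSolution_one hu.smooth hdiv) (locallyIntegrable_const 1) χ h1 h2 h3
    simpa using this.symm
  have htmem : ∀ s ∈ Icc 0 t, s ∈ Icc 0 T := fun s hs => ⟨hs.1, hs.2.trans ht.2⟩
  have htraj' : ∀ x, IsTrajectory u θ t fun s => (Φ (s - t) (t, x)).2 :=
    fun x s hs => htraj (t, x) s (htmem s hs)
  have hX0 : ∀ x, (Φ (0 - t) (t, x)).2 = e.symm x := fun x => by rw [zero_sub]; rfl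
  have h0t : (0 : ℝ) ∈ Icc 0 t := ⟨le_rfl, ht.1⟩
  have htt : t ∈ Icc 0 t := ⟨ht.1, le_rfl⟩
  refine ⟨e.symm, e.symm.measurable, map_symm_restrict_le hball.measurableSet hpres,
    ae_eq_comp_symm_of_integral_eq hball Metric.isBounded_ball hpres
      (hρ.locallyIntegrable t ht) hρ₀ (hdual ρ₀ ρ hρ hρ₀), fun x _ => ?_, fun x hx y hy => ?_⟩
  · have := (htraj' x).r_le hu hθ hθ01 ht.2 hK htt h0t
    rwa [hX0, hXt] at this
  · have hone : ∀ x ∈ Metric.ball (0 : E3) k, ∀ s ∈ Icc 0 t, θ (Φ (s - t) (t, x)).2 = 1 := by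
      intro x hx s hs
      refine hθ1 _ ((hconf (t, x) t ht ?_ s (htmem s hs)).trans (by linarith))
      simp only [hXt]
      exact (mem_ball_zero_iff.1 hx).le
    have := (htraj' x).abs_vertical_sub_sub_le hu hθ ht.2 (htraj' y) (hone x hx) (hone y hy) h0t htt
    simp only [hX0, hXt] at this
    have h2 := abs_sub_abs_le_abs_sub (x 2 - y 2) (e.symm x 2 - e.symm y 2)
    linarith

/-! ### The integral of r^{-2} over a cylindrical shell -/

theorem exists_subset_Icc_of_abs_sub_le {s : Set ℝ} {h : ℝ}
    (hs : ∀ x ∈ s, ∀ y ∈ s, |x - y| ≤ h) : ∃ a, s ⊆ Icc a (a + h) := by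
  rcases s.eq_empty_or_nonempty with rfl | ⟨x₀, hx₀⟩
  · exact ⟨0, empty_subset _⟩
  have hbdd : BddBelow s := ⟨x₀ - h, fun y hy => by have := abs_le.1 (hs x₀ hx₀ y hy); linarith⟩
  refine ⟨sInf s, fun x hx => ⟨csInf_le hbdd hx, ?_⟩⟩
  have : x - h ≤ sInf s := le_csInf ⟨x₀, hx₀⟩ fun y hy => by
    have := abs_le.1 (hs x hx y hy); linarith
  linarith

theorem lintegral_horizontal_mul_vertical {g : ℝ × ℝ → ℝ≥0∞} {k : ℝ → ℝ≥0∞} (hg : Measurable g)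
    (hk : Measurable k) :
    ∫⁻ x : E3, g (x 0, x 1) * k (x 2) = (∫⁻ p, g p) * ∫⁻ s, k s := by
  have h1 := (PiLp.volume_preserving_ofLp (Fin 3)).lintegral_comp
    (f := fun x : Fin 3 → ℝ => g (x 0, x 1) * k (x 2)) (by fun_prop)
  have h2 := (volume_preserving_piFinSuccAbove (fun _ : Fin 3 => ℝ) 2).lintegral_comp
    (f := fun p : ℝ × (Fin 2 → ℝ) => g (p.2 0, p.2 1) * k p.1) (by fun_prop)
  have h3 := (volume_preserving_piFinTwo (fun _ : Fin 2 => ℝ)).lintegral_comp (f := g) hg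
  have h4 : ∫⁻ p : ℝ × (Fin 2 → ℝ), g (p.2 0, p.2 1) * k p.1 =
      (∫⁻ p : ℝ × ℝ, g p) * ∫⁻ s, k s := by
    rw [← h3, mul_comm]
    simp_rw [mul_comm (g _)]
    exact lintegral_prod_mul hk.aemeasurable
      (g := fun y : Fin 2 → ℝ => g (y 0, y 1)) (by fun_prop)
  rw [← h4, ← h2]
  exact h1

theorem lintegral_inv_Ico {a b : ℝ} (ha : 0 < a) (hab : a ≤ b) :
    ∫⁻ s in Ico a b, ENNReal.ofReal s⁻¹ = ENNReal.ofReal (Real.log (b / a)) := by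
  rw [← integral_inv_of_pos ha (ha.trans_le hab), intervalIntegral.integral_of_le hab,
    ← integral_Ico_eq_integral_Ioc, ofReal_integral_eq_lintegral_ofReal]
  · refine (ContinuousOn.integrableOn_Icc (ContinuousOn.inv₀ continuousOn_id fun x hx => ?_)).mono_set
      Ico_subset_Icc_self
    exact (ha.trans_le hx.1).ne'
  · exact (ae_restrict_mem measurableSet_Ico).mono fun x hx => inv_nonneg.2 (ha.le.trans hx.1)

/-- In polar coordinates the integrand becomes s^{-2}·s = s^{-1}, hence the logarithm. -/
theorem lintegral_annulus {a b : ℝ} (ha : 0 < a) (hab : a ≤ b) :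
    ∫⁻ p : ℝ × ℝ, {p : ℝ × ℝ | √(p.1 ^ 2 + p.2 ^ 2) ∈ Ico a b}.indicator
      (fun p => (ENNReal.ofReal (p.1 ^ 2 + p.2 ^ 2))⁻¹) p =
      ENNReal.ofReal (Real.log (b / a)) * ENNReal.ofReal (2 * Real.pi) := by
  rw [← lintegral_comp_polarCoord_symm]
  have h : ∀ p ∈ polarCoord.target, ENNReal.ofReal p.1 •
      {p : ℝ × ℝ | √(p.1 ^ 2 + p.2 ^ 2) ∈ Ico a b}.indicator
      (fun p => (ENNReal.ofReal (p.1 ^ 2 + p.2 ^ 2))⁻¹) (polarCoord.symm p) =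
      (Ico a b).indicator (fun s => ENNReal.ofReal s⁻¹) p.1 * 1 := by
    rintro ⟨s, θ⟩ hp
    have hs : 0 < s := hp.1
    have hsq : (s * Real.cos θ) ^ 2 + (s * Real.sin θ) ^ 2 = s ^ 2 := by
      linear_combination s ^ 2 * Real.sin_sq_add_cos_sq θ
    simp only [polarCoord_symm_apply, indicator, mem_ofPred_eq, hsq, Real.sqrt_sq hs.le, mul_one,
      smul_eq_mul, mul_ite, mul_zero]
    split_ifs
    · rw [← ENNReal.ofReal_inv_of_pos (by positivity), ← ENNReal.ofReal_mul hs.le]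
      congr 1
      field_simp
    · rfl
  have hinter : Ico a b ∩ Ioi 0 = Ico a b :=
    inter_eq_left.2 fun x hx => mem_Ioi.2 (ha.trans_le hx.1)
  rw [setLIntegral_congr_fun polarCoord.open_target.measurableSet h, polarCoord_target,
    Measure.volume_eq_prod, ← Measure.prod_restrict,
    lintegral_prod_mul (f := (Ico a b).indicator fun s => ENNReal.ofReal s⁻¹)
      (g := fun _ : ℝ => (1 : ℝ≥0∞)) (by
        exact ((by fun_prop : Measurable fun s : ℝ => ENNReal.ofReal s⁻¹).indicator
          measurableSet_Ico).aemeasurable) (by fun_prop),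
    lintegral_indicator measurableSet_Ico, Measure.restrict_restrict measurableSet_Ico,
    hinter, lintegral_inv_Ico ha hab]
  congr 1
  simp [two_mul]

theorem lintegral_cylinder {a b : ℝ} (ha : 0 < a) (hab : a ≤ b) (c h : ℝ) :
    ∫⁻ x : E3, {x : E3 | r x ∈ Ico a b ∧ x 2 ∈ Icc c (c + h)}.indicator
      (fun x => (ENNReal.ofReal (r x ^ 2))⁻¹) x =
      ENNReal.ofReal (Real.log (b / a)) * ENNReal.ofReal (2 * Real.pi) * ENNReal.ofReal h := by
  have hm : Measurable ({p : ℝ × ℝ | √(p.1 ^ 2 + p.2 ^ 2) ∈ Ico a b}.indicator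
      fun p => (ENNReal.ofReal (p.1 ^ 2 + p.2 ^ 2))⁻¹) :=
    Measurable.indicator (by fun_prop)
      ((by fun_prop : Measurable fun p : ℝ × ℝ => √(p.1 ^ 2 + p.2 ^ 2)) measurableSet_Ico)
  have hk : Measurable ((Icc c (c + h)).indicator fun _ => (1 : ℝ≥0∞)) :=
    measurable_const.indicator measurableSet_Icc
  have hvol : ∫⁻ s, (Icc c (c + h)).indicator (fun _ => (1 : ℝ≥0∞)) s = ENNReal.ofReal h := by
    rw [lintegral_indicator measurableSet_Icc]; simp
  rw [← lintegral_annulus ha hab, ← hvol, ← lintegral_horizontal_mul_vertical hm hk]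
  congr 1 with x
  simp only [indicator, mem_ofPred_eq, r_sq, mul_ite, mul_one, mul_zero]
  rw [ite_and]
  change _ = if _ then (if r x ∈ Ico a b then _ else _) else _
  split_ifs <;> rfl

/-! ### Essential support and the final estimate -/

/-- The exceptional set is locally null, and a locally null set is null in a second countable space.
-/
theorem ae_mem_essSupport (f : E3 → ℝ) : ∀ᵐ x ∂volume, f x ≠ 0 → x ∈ essSupport f := by
  have h : volume {x | f x ≠ 0 ∧ x ∉ essSupport f} = 0 := by
    refine measure_null_of_locally_null _ fun x hx => ?_
    have hx2 := hx.2
    simp only [essSupport, mem_ofPred_eq, not_forall, not_not] at hx2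
    obtain ⟨U, hU, hf⟩ := hx2
    obtain ⟨V, hVU, hV, hxV⟩ := mem_nhds_iff.1 hU
    refine ⟨{x | f x ≠ 0} ∩ V, ?_, ?_⟩
    · rw [mem_nhdsWithin]
      exact ⟨V, hV, hxV, fun y hy => ⟨hy.2.1, hy.1⟩⟩
    · have := ae_restrict_of_ae_restrict_of_subset hVU hf
      rwa [ae_iff, Measure.restrict_apply' hV.measurableSet] at this
  rw [ae_iff]
  simpa only [Classical.not_imp] using h

theorem suppAxisDist_le_r {f : E3 → ℝ} {x : E3} (hx : x ∈ essSupport f) :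
    suppAxisDist f ≤ ENNReal.ofReal (r x) := by
  refine (iInf₂_le x hx).trans ?_
  have hy : (!₂[0, 0, x 2] : E3) ∈ axis := by simp [axis]
  refine (Metric.infEDist_le_edist_of_mem hy).trans_eq ?_
  rw [edist_dist, EuclideanSpace.dist_eq, Fin.sum_univ_three]
  simp [r]

theorem abs_vertical_sub_le_suppHeight {f : E3 → ℝ} (hf : suppHeight f < ⊤) {x y : E3}
    (hx : x ∈ essSupport f) (hy : y ∈ essSupport f) : |x 2 - y 2| ≤ (suppHeight f).toReal := by
  have h := Metric.edist_le_ediam_of_mem (mem_image_of_mem (fun x : E3 => x 2) hx)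
    (mem_image_of_mem (fun x : E3 => x 2) hy)
  rw [← Real.dist_eq, ← ENNReal.toReal_ofReal (dist_nonneg (x := x 2)), ← edist_dist]
  exact ENNReal.toReal_mono hf.ne h

theorem eLpNorm_two_pow_two_eq_lintegral {α : Type*} [MeasurableSpace α] (μ : Measure α)
    (f : α → ℝ) : eLpNorm f 2 μ ^ 2 = ∫⁻ x, ‖f x‖ₑ ^ 2 ∂μ := by
  have h := eLpNorm_nnreal_pow_eq_lintegral (μ := μ) (f := f) (p := 2) two_ne_zero
  simpa using h

theorem lintegral_le_of_forall_ball {f : E3 → ℝ≥0∞} {C : ℝ≥0∞}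
    (h : ∀ k : ℝ, 0 < k → ∫⁻ x in Metric.ball 0 k, f x ≤ C) : ∫⁻ x, f x ≤ C := by
  have hmono : Monotone fun n : ℕ => Metric.ball (0 : E3) (n + 1) := fun m n hmn =>
    Metric.ball_subset_ball (by simpa using hmn)
  rw [← setLIntegral_univ, ← Metric.iUnion_ball_nat_succ (0 : E3),
    setLIntegral_iUnion_of_directed f hmono.directed_le]
  exact iSup_le fun n => h _ (by positivity)

theorem IsAdmissible.of_hypotheses {T : ℝ} {u : ℝ → E3 → E3}
    (smooth : ContDiffOn ℝ ∞ (fun p : ℝ × E3 => u p.1 p.2) (Icc 0 T ×ˢ univ))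
    (axisymmetric : ∀ t ∈ Icc 0 T, IsAxisymmetric (u t))
    (hdiv : ∀ t ∈ Icc 0 T, ∀ x, div (u t) x = 0)
    (hgrad : ∀ᵐ τ ∂(volume.restrict (Icc 0 T)), MemLp (hGrad (u τ)) 2 volume)
    (hcurl : ∀ᵐ τ ∂(volume.restrict (Icc 0 T)), MemLp (hGrad (curl (u τ))) 2 volume)
    (radialInt_lt : radialInt u T < ⊤) (hGradInt_lt : hGradInt u T < ⊤) :
    IsAdmissible T u where
  smooth := smooth
  axisymmetric := axisymmetric
  radialInt_lt := radialInt_lt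
  hGradInt_lt := hGradInt_lt
  vertical := by
    filter_upwards [hgrad, hcurl, ae_restrict_mem measurableSet_Icc] with τ h1 h2 hτ x y
    exact enorm_vertical_sub_le
      ((contDiff_slice smooth hτ).of_le (WithTop.coe_le_coe.2 (le_top : (2 : ℕ∞) ≤ ⊤)))
      (hdiv τ hτ) h1 h2 x y

theorem lintegral_comp_le_of_map_le {P : E3 → E3} {B : Set E3} (hP : Measurable P)
    (hmap : (volume.restrict B).map P ≤ volume) {f : E3 → ℝ≥0∞} (hf : AEMeasurable f volume) :
    ∫⁻ x in B, f (P x) ≤ ∫⁻ x, f x := by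
  rw [← lintegral_map' (hf.mono_measure hmap) hP.aemeasurable]
  exact lintegral_mono' hmap le_rfl

/-- The estimate for a density transported by a measure-nonincreasing map that distorts the distance
to the axis by a factor at most `exp G` and shrinks vertical distances by at most `H`. -/
theorem lintegral_div_r_sq_le {ρ₀ f : E3 → ℝ} {P : E3 → E3} {B : Set E3} {G H : ℝ}
    (hB : MeasurableSet B) (hP : Measurable P) (hmap : (volume.restrict B).map P ≤ volume)
    (hf : f =ᵐ[volume.restrict B] ρ₀ ∘ P) (hG : 0 ≤ G) (hH : 0 ≤ H)
    (hr : ∀ x ∈ B, r (P x) ≤ r x * Real.exp G)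
    (hz : ∀ x ∈ B, ∀ y ∈ B, |x 2 - y 2| ≤ |P x 2 - P y 2| + H)
    (hρ₀ : AEStronglyMeasurable ρ₀ volume)
    (hr₀ : 0 < suppAxisDist ρ₀) (hd₀ : suppHeight ρ₀ < ⊤) :
    ∫⁻ x in B, ‖f x / r x‖ₑ ^ 2 ≤
      (suppAxisDist ρ₀ ^ 2)⁻¹ * eLpNorm ρ₀ 2 volume ^ 2 +
        ENNReal.ofReal (2 * Real.pi) * eLpNorm ρ₀ ⊤ volume ^ 2 * ENNReal.ofReal G *
          (suppHeight ρ₀ + ENNReal.ofReal H) := by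
  have hac : ∀ {p : E3 → Prop}, (∀ᵐ x ∂volume, p x) → ∀ᵐ x ∂volume.restrict B, p (P x) :=
    fun h => ae_of_ae_map hP.aemeasurable (ae_mono hmap h)
  have hsupp := hac (ae_mem_essSupport ρ₀)
  have hbound := hac (enorm_ae_le_eLpNormEssSup ρ₀ volume)
  -- An empty essential support makes the distance to the axis infinite, so it cannot be read as a
  -- real number; but then the density vanishes almost everywhere.
  rcases (essSupport ρ₀).eq_empty_or_nonempty with hem | ⟨x₀, hx₀⟩
  · have hzero : ∀ᵐ x ∂volume.restrict B, ‖f x / r x‖ₑ ^ 2 = 0 := by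
      filter_upwards [hsupp, hf] with x hx hfx
      have : ρ₀ (P x) = 0 := by
        by_contra h
        simpa [hem] using hx h
      simp [hfx, this]
    rw [lintegral_congr_ae hzero]
    simp
  have hR_top : suppAxisDist ρ₀ ≠ ⊤ := ((suppAxisDist_le_r hx₀).trans_lt ENNReal.ofReal_lt_top).ne
  obtain ⟨R, hR⟩ : ∃ R, R = (suppAxisDist ρ₀).toReal := ⟨_, rfl⟩
  have hRpos : 0 < R := hR ▸ ENNReal.toReal_pos hr₀.ne' hR_top
  have hRof : suppAxisDist ρ₀ = ENNReal.ofReal R := by rw [hR, ENNReal.ofReal_toReal hR_top]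
  have hRle : ∀ {y}, y ∈ essSupport ρ₀ → R ≤ r y := fun hy => by
    have := suppAxisDist_le_r hy
    rwa [hRof, ENNReal.ofReal_le_ofReal_iff (r_nonneg _)] at this
  obtain ⟨c, hc⟩ := exists_subset_Icc_of_abs_sub_le
    (s := (fun x : E3 => x 2) '' {x ∈ B | P x ∈ essSupport ρ₀})
    (h := (suppHeight ρ₀).toReal + H) (by
      rintro _ ⟨x, ⟨hx, hPx⟩, rfl⟩ _ ⟨y, ⟨hy, hPy⟩, rfl⟩
      have := hz x hx y hy
      have := abs_vertical_sub_le_suppHeight hd₀ hPx hPy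
      linarith)
  -- The least distance to the axis that transported mass can have; the logarithm log(R/a) of the
  -- shell is then exactly G.
  obtain ⟨a, ha⟩ : ∃ a, a = R * Real.exp (-G) := ⟨_, rfl⟩
  have ha_pos : 0 < a := by rw [ha]; positivity
  have haR : a ≤ R := by
    rw [ha]; exact mul_le_of_le_one_right hRpos.le (Real.exp_le_one_iff.2 (by linarith))
  have hlog : Real.log (R / a) = G := by
    rw [ha, Real.exp_neg, show R / (R * (Real.exp G)⁻¹) = Real.exp G by field_simp, Real.log_exp]
  obtain ⟨h, hh⟩ : ∃ h, h = (suppHeight ρ₀).toReal + H := ⟨_, rfl⟩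
  have hhof : ENNReal.ofReal h = suppHeight ρ₀ + ENNReal.ofReal H := by
    rw [hh, ENNReal.ofReal_add ENNReal.toReal_nonneg hH, ENNReal.ofReal_toReal hd₀.ne]
  rw [← hh] at hc
  obtain ⟨g, hg⟩ : ∃ g : E3 → ℝ≥0∞, g = {x : E3 | r x ∈ Ico a R ∧ x 2 ∈ Icc c (c + h)}.indicator
      (fun x => (ENNReal.ofReal (r x ^ 2))⁻¹) := ⟨_, rfl⟩
  have hg_meas : Measurable g := by
    have hr_meas : Measurable r := continuous_r.measurable
    rw [hg]
    refine Measurable.indicator (by fun_prop) ((hr_meas measurableSet_Ico).inter ?_)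
    exact (by fun_prop : Measurable fun x : E3 => x 2) measurableSet_Icc
  have hpt : ∀ᵐ x ∂volume.restrict B, ‖f x / r x‖ₑ ^ 2 ≤
      (suppAxisDist ρ₀ ^ 2)⁻¹ * ‖ρ₀ (P x)‖ₑ ^ 2 + eLpNorm ρ₀ ⊤ volume ^ 2 * g x := by
    filter_upwards [hsupp, hbound, hf, ae_restrict_mem hB] with x hx hbx hfx hxB
    rw [hfx, Function.comp_apply]
    by_cases hzero : ρ₀ (P x) = 0
    · simp [hzero]
    have hPx := hx hzero
    have hax : a ≤ r x := by
      have h1 := (hRle hPx).trans (hr x hxB)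
      have h2 := mul_le_mul_of_nonneg_right h1 (Real.exp_pos (-G)).le
      rwa [mul_assoc, ← Real.exp_add, add_neg_cancel, Real.exp_zero, mul_one, ← ha] at h2
    have hrx : 0 < r x := ha_pos.trans_le hax
    have heq : ‖ρ₀ (P x) / r x‖ₑ ^ 2 = (ENNReal.ofReal (r x ^ 2))⁻¹ * ‖ρ₀ (P x)‖ₑ ^ 2 := by
      rw [div_eq_mul_inv, enorm_mul, mul_pow, mul_comm, Real.enorm_of_nonneg (inv_nonneg.2 hrx.le),
        ENNReal.ofReal_inv_of_pos hrx, ← ENNReal.inv_pow, ENNReal.ofReal_pow hrx.le]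
    rw [heq]
    -- Far from the axis the first term alone dominates; near it x lies in the shell, and the second
    -- term does.
    by_cases hRx : R ≤ r x
    · refine le_add_right (mul_le_mul_left ?_ _)
      rw [hRof, ← ENNReal.ofReal_pow hRpos.le]
      exact ENNReal.inv_le_inv.2 (ENNReal.ofReal_le_ofReal (pow_le_pow_left₀ hRpos.le hRx 2))
    · have hgx : g x = (ENNReal.ofReal (r x ^ 2))⁻¹ := by
        rw [hg, indicator_of_mem]
        exact ⟨⟨hax, not_le.1 hRx⟩, hc ⟨x, ⟨hxB, hPx⟩, rfl⟩⟩
      rw [hgx, mul_comm]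
      refine le_add_left (mul_le_mul_left (pow_le_pow_left' ?_ 2) _)
      rwa [eLpNorm_exponent_top]
  have hint : ∫⁻ x, g x =
      ENNReal.ofReal G * ENNReal.ofReal (2 * Real.pi) * ENNReal.ofReal h := by
    rw [← hlog, ← lintegral_cylinder ha_pos haR c h, hg]
  calc ∫⁻ x in B, ‖f x / r x‖ₑ ^ 2
      ≤ ∫⁻ x in B, (suppAxisDist ρ₀ ^ 2)⁻¹ * ‖ρ₀ (P x)‖ₑ ^ 2 + eLpNorm ρ₀ ⊤ volume ^ 2 * g x :=
        lintegral_mono_ae hpt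
    _ = (∫⁻ x in B, (suppAxisDist ρ₀ ^ 2)⁻¹ * ‖ρ₀ (P x)‖ₑ ^ 2) +
          eLpNorm ρ₀ ⊤ volume ^ 2 * ∫⁻ x in B, g x := by
        rw [lintegral_add_right _ (hg_meas.const_mul _), lintegral_const_mul _ hg_meas]
    _ ≤ (suppAxisDist ρ₀ ^ 2)⁻¹ * eLpNorm ρ₀ 2 volume ^ 2 +
          eLpNorm ρ₀ ⊤ volume ^ 2 * ∫⁻ x, g x := by
        have hm : AEMeasurable (fun x => ‖ρ₀ x‖ₑ ^ 2) volume := hρ₀.enorm.pow_const 2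
        refine add_le_add ?_ (mul_le_mul_right (setLIntegral_le_lintegral _ _) _)
        rw [eLpNorm_two_pow_two_eq_lintegral, ← lintegral_const_mul'' _ hm]
        exact lintegral_comp_le_of_map_le hP hmap (hm.const_mul _)
    _ = _ := by rw [hint, hhof]; ring

end Axisym

theorem mainTheorem4
    (T : ℝ) (u : ℝ → Axisym.E3 → Axisym.E3) (ρ₀ : Axisym.E3 → ℝ) (ρ : ℝ → Axisym.E3 → ℝ)
    (hu_smooth : ContDiffOn ℝ ∞ (fun p : ℝ × Axisym.E3 => u p.1 p.2) (Icc 0 T ×ˢ univ))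
    (hu_axi : ∀ t ∈ Icc 0 T, Axisym.IsAxisymmetric (u t))
    (hu_div : ∀ t ∈ Icc 0 T, ∀ x, Axisym.div (u t) x = 0)
    (hu_grad : ∀ᵐ τ ∂(volume.restrict (Icc 0 T)), MemLp (Axisym.hGrad (u τ)) 2 volume)
    (hω_grad : ∀ᵐ τ ∂(volume.restrict (Icc 0 T)),
      MemLp (Axisym.hGrad (Axisym.curl (u τ))) 2 volume)
    (hu_rad_fin : Axisym.radialInt u T < ⊤)
    (hu_grad_fin : Axisym.hGradInt u T < ⊤)
    (hρ : Axisym.IsTransportSolution T u ρ₀ ρ)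
    (hρ₀_two : MemLp ρ₀ 2 volume) (hρ₀_top : MemLp ρ₀ ⊤ volume)
    (hr₀ : 0 < Axisym.suppAxisDist ρ₀) (hd₀ : Axisym.suppHeight ρ₀ < ⊤) :
    ∀ t ∈ Icc 0 T,
      eLpNorm (fun x => ρ t x / Axisym.r x) 2 volume ^ 2 ≤
        (Axisym.suppAxisDist ρ₀ ^ 2)⁻¹ * eLpNorm ρ₀ 2 volume ^ 2 +
          ENNReal.ofReal (2 * Real.pi) * eLpNorm ρ₀ ⊤ volume ^ 2 * Axisym.radialInt u t *
            (Axisym.suppHeight ρ₀ + 2 * Axisym.hGradInt u t) := by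
  intro t ht
  have hu := Axisym.IsAdmissible.of_hypotheses hu_smooth hu_axi hu_div hu_grad hω_grad
    hu_rad_fin hu_grad_fin
  have hG : Axisym.radialInt u t ≠ ⊤ := ((Axisym.radialInt_mono ht.2).trans_lt hu_rad_fin).ne
  have hH : 2 * Axisym.hGradInt u t ≠ ⊤ :=
    ENNReal.mul_ne_top ENNReal.ofNat_ne_top ((Axisym.hGradInt_mono ht.2).trans_lt hu_grad_fin).ne
  rw [Axisym.eLpNorm_two_pow_two_eq_lintegral]
  -- The backward map depends on the ball, through the cutoff, but the bound does not; monotone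
  -- convergence then gives the whole space.
  refine Axisym.lintegral_le_of_forall_ball fun k hk => ?_
  obtain ⟨P, hP, hmap, hρP, hr, hz⟩ := hρ.exists_backward_map hu hu_div
    (hρ₀_two.locallyIntegrable one_le_two) ht hk
  have h := Axisym.lintegral_div_r_sq_le measurableSet_ball hP hmap hρP ENNReal.toReal_nonneg
    ENNReal.toReal_nonneg hr hz hρ₀_two.1 hr₀ hd₀
  rwa [ENNReal.ofReal_toReal hG, ENNReal.ofReal_toReal hH] at h
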